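/- A database $D\in\{\pm1\}^{n\times d}$ has rows $D_1,\dots,D_n$; its one-way marginals are $\overline D=\frac1n\sum_{i=1}^n D_i\in[-1,1]^d$. A randomized mechanism $M:\{\pm1\}^{n\times d}\to[-1,1]^d$ is $(\varepsilon,\delta)$-differentially private if $\Pr[M(D)\in S]\le e^{\varepsilon}\Pr[M(D')\in S]+\delta$ for all measurable $S\subseteq[-1,1]^d$ and all $D,D'$ that differ only in a single row. There are a randomized algorithm $P$, a polynomial $p$ and a function $w:\mathbb N\to\mathbb R$ with $w(d)\to\infty$ as $d\to\infty$ (so $d^{-w(d)}=d^{-\omega(1)}$) such that the following holds. For all constants $\varepsilon_0$ and $\delta_0<1$ there is a constant $C>0$ such that for all $0<\varepsilon\le\varepsilon_0$, $0<\delta\le\delta_0$, $\alpha>0$ and all integers $d\ge1$, $n\ge1$ with $$n\;\ge\; C\cdot\frac{\sqrt{d\cdot\log(1/\delta)\cdot\log\log d}}{\varepsilon\,\alpha}$$ (the square root is read as $0$ when $d\le2$), the algorithm $P$, given $n,d,\varepsilon,\delta,\alpha$, implements a mechanism $M:\{\pm1\}^{n\times d}\to[-1,1]^d$ that is $(\varepsilon,\delta)$-differentially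 private and satisfies $$\forall D\in\{\pm1\}^{n\times d}\qquad \Pr_M\bigl[\|M(D)-\overline D\|_\infty\ge\alpha\bigr]\le\frac1{d^{\,w(d)}},$$ and $P$ always performs at most $p(n,d)$ steps. Here algorithms compute with exact real numbers and natural-number registers; arithmetic operations, square roots, logarithms, comparisons, memory accesses, loop iterations, and independent draws from the uniform distribution on $[0,1]$ and from $N(0,1)$ cost one step each. -/

import Mathlib

open MeasureTheory ProbabilityTheory Filter

noncomputable section

namespace OneWayMarginals

/-! ### Databases, marginals, differential privacy -/

/-- Databases in `{±1}^{n × d}`; the `n` rows are the individuals. -/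
abbrev Database (n d : ℕ) : Type := Matrix (Fin n) (Fin d) ℤˣ

/-- The vector of one-way marginals `(1/n) ∑ᵢ Dᵢ`. -/
def marginals {n d : ℕ} (D : Database n d) : Fin d → ℝ :=
  fun j => (1 / (n : ℝ)) * ∑ i, (((D i j : ℤˣ) : ℤ) : ℝ)

/-- Two databases are adjacent if they differ only in a single row. -/
def Adjacent {n d : ℕ} (D D' : Database n d) : Prop :=
  ∃ i, ∀ i', i' ≠ i → D i' = D' i'

/-- The cube `[-1, 1]^d`. -/
abbrev Cube (d : ℕ) : Type := Fin d → Set.Icc (-1 : ℝ) 1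

/-- The inclusion of the cube in `ℝ^d` (with the sup norm). -/
def Cube.toReal {d : ℕ} (y : Cube d) : Fin d → ℝ := fun j => (y j : ℝ)

/-- A randomized mechanism `{±1}^{n × d} → [±1]^d`, given by its output distributions. -/
abbrev Mechanism (n d : ℕ) : Type := Database n d → ProbabilityMeasure (Cube d)

/-- `(ε, δ)`-differential privacy. -/
def IsDP {n d : ℕ} (ε δ : ℝ) (M : Mechanism n d) : Prop :=
  ∀ D D' : Database n d, Adjacent D D' → ∀ S : Set (Cube d), MeasurableSet S →
    (M D : Measure (Cube d)).real S ≤ Real.exp ε * (M D' : Measure (Cube d)).real S + δ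

/-! ### Randomized algorithms over the reals, with a step count

A program works on natural-number registers and on arrays of real numbers. Every arithmetic
operation, memory access, comparison, random draw and loop iteration costs one step. There is no
operation that turns a real number into a natural number, and the only constants are
natural numbers. -/

/-- Natural-number expressions; `sub` is truncated subtraction. -/
inductive NExpr : Type
  | const (k : ℕ)
  | reg (r : ℕ)
  | add (e f : NExpr)
  | sub (e f : NExpr)

/-- Real expressions. `read a i` is cell `i` of array `a`, `data i j` is the entry `D_{ij}` of the
input database, `unif i` is the `i`-th of a sequence of independent uniform samples from
`[0, 1]`, and `normal i` is the `i`-th of a sequence of independent standard normal samples. -/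
inductive RExpr : Type
  | ofNat (e : NExpr)
  | read (a : ℕ) (i : NExpr)
  | data (i j : NExpr)
  | unif (i : NExpr)
  | normal (i : NExpr)
  | add (x y : RExpr)
  | sub (x y : RExpr)
  | mul (x y : RExpr)
  | div (x y : RExpr)
  | sqrt (x : RExpr)
  | log (x : RExpr)

/-- Programs: assignments to a register or to an array cell, composition, branching on a
comparison `x ≤ y` of reals, and `loop r e s`, which evaluates `e` once, to `N` say, and then runs
`s` with register `r` set to `0, …, N - 1` in turn. -/
inductive Program : Type
  | skip
  | setNat (r : ℕ) (e : NExpr)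
  | setReal (a : ℕ) (i : NExpr) (x : RExpr)
  | seq (s t : Program)
  | ifLE (x y : RExpr) (s t : Program)
  | loop (r : ℕ) (e : NExpr) (s : Program)

/-- The working memory: registers and arrays. -/
structure State : Type where
  nat : ℕ → ℕ
  real : ℕ → ℕ → ℝ

/-- The results of the random draws: uniform samples and standard normal samples. -/
abbrev Randomness : Type := (ℕ → unitInterval) × (ℕ → ℝ)

/-- The law of the random draws: all of them are independent. -/
def randomnessLaw : Measure Randomness :=
  (Measure.infinitePi fun _ : ℕ => (volume : Measure unitInterval)).prod
    (Measure.infinitePi fun _ : ℕ => gaussianReal 0 1)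

/-- What a program can read but not change. -/
structure Env : Type where
  data : ℕ → ℕ → ℝ
  rand : Randomness

def State.setNat (σ : State) (r k : ℕ) : State :=
  { σ with nat := Function.update σ.nat r k }

def State.setReal (σ : State) (a i : ℕ) (x : ℝ) : State :=
  { σ with real := Function.update σ.real a (Function.update (σ.real a) i x) }

def NExpr.eval (σ : State) : NExpr → ℕ
  | .const k => k
  | .reg r => σ.nat r
  | .add e f => e.eval σ + f.eval σ
  | .sub e f => e.eval σ - f.eval σ

def NExpr.cost : NExpr → ℕ
  | .const _ => 1
  | .reg _ => 1
  | .add e f => e.cost + f.cost + 1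
  | .sub e f => e.cost + f.cost + 1

def RExpr.eval (E : Env) (σ : State) : RExpr → ℝ
  | .ofNat e => (e.eval σ : ℝ)
  | .read a i => σ.real a (i.eval σ)
  | .data i j => E.data (i.eval σ) (j.eval σ)
  | .unif i => (E.rand.1 (i.eval σ) : ℝ)
  | .normal i => E.rand.2 (i.eval σ)
  | .add x y => x.eval E σ + y.eval E σ
  | .sub x y => x.eval E σ - y.eval E σ
  | .mul x y => x.eval E σ * y.eval E σ
  | .div x y => x.eval E σ / y.eval E σ
  | .sqrt x => Real.sqrt (x.eval E σ)
  | .log x => Real.log (x.eval E σ)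

def RExpr.cost : RExpr → ℕ
  | .ofNat e => e.cost + 1
  | .read _ i => i.cost + 1
  | .data i j => i.cost + j.cost + 1
  | .unif i => i.cost + 1
  | .normal i => i.cost + 1
  | .add x y => x.cost + y.cost + 1
  | .sub x y => x.cost + y.cost + 1
  | .mul x y => x.cost + y.cost + 1
  | .div x y => x.cost + y.cost + 1
  | .sqrt x => x.cost + 1
  | .log x => x.cost + 1

/-- `iter f N σ` applies `f 0`, `f 1`, …, `f (N - 1)` to `σ`, in this order. -/
def iter (f : ℕ → State → State) : ℕ → State → State
  | 0, σ => σ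
  | N + 1, σ => f N (iter f N σ)

open Classical in
/-- The memory after running a program. -/
def Program.exec (E : Env) : Program → State → State
  | .skip, σ => σ
  | .setNat r e, σ => σ.setNat r (e.eval σ)
  | .setReal a i x, σ => σ.setReal a (i.eval σ) (x.eval E σ)
  | .seq s t, σ => t.exec E (s.exec E σ)
  | .ifLE x y s t, σ => if x.eval E σ ≤ y.eval E σ then s.exec E σ else t.exec E σ
  | .loop r e s, σ => iter (fun k τ => s.exec E (τ.setNat r k)) (e.eval σ) σ

open Classical in
/-- The number of steps that a program performs. -/
def Program.steps (E : Env) : Program → State → ℕ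
  | .skip, _ => 1
  | .setNat _ e, _ => e.cost + 1
  | .setReal _ i x, _ => i.cost + x.cost + 1
  | .seq s t, σ => s.steps E σ + t.steps E (s.exec E σ)
  | .ifLE x y s t, σ =>
      x.cost + y.cost + 1 + if x.eval E σ ≤ y.eval E σ then s.steps E σ else t.steps E σ
  | .loop r e s, σ =>
      e.cost + 1 + ∑ k ∈ Finset.range (e.eval σ),
        (1 + s.steps E ((iter (fun l τ => s.exec E (τ.setNat r l)) k σ).setNat r k))

/-- The input database (entries outside the `n × d` range read as `0`) and the random draws. -/
def inputEnv {n d : ℕ} (D : Database n d) (ω : Randomness) : Env where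
  data i j := if h : i < n ∧ j < d then (((D ⟨i, h.1⟩ ⟨j, h.2⟩ : ℤˣ) : ℤ) : ℝ) else 0
  rand := ω

/-- The initial memory: registers `0`, `1` hold `n`, `d`; cells `0`, `1`, `2` of array `0` hold
`ε`, `δ`, `α`; everything else is `0`. -/
def initState (n d : ℕ) (ε δ α : ℝ) : State where
  nat r := if r = 0 then n else if r = 1 then d else 0
  real a i :=
    if a = 0 then (if i = 0 then ε else if i = 1 then δ else if i = 2 then α else 0) else 0

/-- The output of a program: the cells `0, …, d - 1` of array `1` at the end. -/
def Program.output (P : Program) {n d : ℕ} (ε δ α : ℝ) (D : Database n d) (ω : Randomness) :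
    Fin d → ℝ :=
  fun j => (P.exec (inputEnv D ω) (initState n d ε δ α)).real 1 j

/-- The number of steps on the given input, with the given results of the random draws. -/
def Program.runtime (P : Program) {n d : ℕ} (ε δ α : ℝ) (D : Database n d) (ω : Randomness) : ℕ :=
  P.steps (inputEnv D ω) (initState n d ε δ α)

/-- With parameters `ε`, `δ`, `α`, the program `P` is an implementation of the mechanism `M`:
on every database its output has the law that `M` prescribes. -/
def Program.Implements (P : Program) {n d : ℕ} (ε δ α : ℝ) (M : Mechanism n d) : Prop :=
  ∀ D : Database n d, Measurable (P.output ε δ α D) ∧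
    randomnessLaw.map (P.output ε δ α D) = (M D : Measure (Cube d)).map Cube.toReal

end OneWayMarginals

end

open OneWayMarginals

/-! The mechanism adds noise to the marginals and projects onto the cube. There are two kinds of
noise.

If `d` is greater than `(1 + log (1 / δ)) * log (log d)`, then the coordinates of the noise are
independent with tail `P(|Z| > a) = exp (1 - exp (tailExponent κ a))`, where `κ ^ 2 = log (log d)`.
This tail is doubly exponential: all `d` coordinates are of order `κ` except with probability
`exp (-(log d) ^ 2)` up to polynomial factors, where Gaussian noise would need `√(log d)` in place
of `κ`. The derivative of the log-density is large only where the density is small, so that the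
privacy loss of a shift has exponential moments of sub-Gaussian size, and a Chernoff bound for its
sum over the coordinates gives `(ε, δ)`-privacy.

For smaller `d` the noise is uniform on a cube of half-width `r / ‖U‖`, where `U` is a uniform point
of the unit cube. A shift of this noise is a shear of the random seed followed by a contraction,
which changes probabilities by a factor of at most `exp ε`. The noise is large only if `U` is small,
and the probability of this is exponentially small in `d`.

If `log (log d) ≤ 1`, then the accuracy bound is void and the output is constant. -/

noncomputable section

namespace OneWayMarginals

/-! ### The light-tailed noise -/

/-- The light-tailed noise `Z` is given by `P(|Z| > a) = exp (1 - exp (tailExponent κ a))` for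
`0 ≤ a`. The slope of the exponent rises from `1` at `0` to `κ` at infinity. -/
def tailExponent (κ a : ℝ) : ℝ := κ * √(κ ^ 2 - 1 + (1 + a) ^ 2) - κ ^ 2

/-- The slope of `tailExponent κ`. -/
def tailSlope (κ a : ℝ) : ℝ := κ * (1 + a) / √(κ ^ 2 - 1 + (1 + a) ^ 2)

/-- The inverse of `tailExponent κ` on `[0, ∞)`. -/
def tailExponentInv (κ y : ℝ) : ℝ := √(1 + 2 * y + (y / κ) ^ 2) - 1

section tailExponent

variable {κ a y : ℝ}

lemma radicand_pos (hκ : 1 ≤ κ) (ha : 0 ≤ a) : 0 < κ ^ 2 - 1 + (1 + a) ^ 2 := by nlinarith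

lemma tailExponent_zero (hκ : 0 ≤ κ) : tailExponent κ 0 = 0 := by
  rw [tailExponent, add_zero, one_pow, sub_add_cancel, Real.sqrt_sq hκ, sq, sub_self]

lemma tailExponentInv_nonneg (hy : 0 ≤ y) : 0 ≤ tailExponentInv κ y :=
  sub_nonneg.2 (Real.one_le_sqrt.2 (by nlinarith [sq_nonneg (y / κ)]))

lemma tailExponent_tailExponentInv (hκ : 0 < κ) (hy : 0 ≤ y) :
    tailExponent κ (tailExponentInv κ y) = y := by
  have hsq : κ ^ 2 - 1 + (1 + 2 * y + (y / κ) ^ 2) = (κ + y / κ) ^ 2 := by field_simp; ring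
  rw [tailExponent, tailExponentInv, add_sub_cancel, Real.sq_sqrt (by positivity), hsq,
    Real.sqrt_sq (by positivity)]
  field_simp
  ring

lemma tailExponentInv_tailExponent (hκ : 1 ≤ κ) (ha : 0 ≤ a) :
    tailExponentInv κ (tailExponent κ a) = a := by
  have hR := Real.sq_sqrt (radicand_pos hκ ha).le
  have hsq : 1 + 2 * tailExponent κ a + (tailExponent κ a / κ) ^ 2 = (1 + a) ^ 2 := by
    rw [tailExponent]
    field_simp
    linear_combination hR
  rw [tailExponentInv, hsq, Real.sqrt_sq (by linarith), add_sub_cancel_left]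

lemma hasDerivAt_tailExponent (hκ : 1 ≤ κ) (ha : 0 ≤ a) :
    HasDerivAt (tailExponent κ) (tailSlope κ a) a := by
  have h : HasDerivAt (fun a => κ ^ 2 - 1 + (1 + a) ^ 2) (2 * (1 + a)) a := by
    simpa using (((hasDerivAt_id a).const_add 1).pow 2).const_add (κ ^ 2 - 1)
  refine (((h.sqrt (radicand_pos hκ ha).ne').const_mul κ).sub_const (κ ^ 2)).congr_deriv ?_
  rw [tailSlope]
  field_simp

lemma one_le_tailSlope (hκ : 1 ≤ κ) (ha : 0 ≤ a) : 1 ≤ tailSlope κ a := by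
  rw [tailSlope, one_le_div (Real.sqrt_pos.2 (radicand_pos hκ ha)),
    Real.sqrt_le_left (by positivity)]
  nlinarith [mul_nonneg (by nlinarith : 0 ≤ κ ^ 2 - 1) (by nlinarith : 0 ≤ (1 + a) ^ 2 - 1)]

lemma tailSlope_le (hκ : 1 ≤ κ) (ha : 0 ≤ a) : tailSlope κ a ≤ κ := by
  have hR : 1 + a ≤ √(κ ^ 2 - 1 + (1 + a) ^ 2) := Real.le_sqrt_of_sq_le (by nlinarith)
  rw [tailSlope, div_le_iff₀ (by linarith)]
  gcongr

lemma tailSlope_le_one_add (hκ : 1 ≤ κ) (ha : 0 ≤ a) : tailSlope κ a ≤ 1 + a := by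
  have hR : κ ≤ √(κ ^ 2 - 1 + (1 + a) ^ 2) := Real.le_sqrt_of_sq_le (by nlinarith)
  rw [tailSlope, div_le_iff₀ (by linarith), mul_comm]
  gcongr

lemma tailExponent_sub_mem_Icc (hκ : 1 ≤ κ) {b : ℝ} (ha : 0 ≤ a) (hab : a ≤ b) :
    tailExponent κ b - tailExponent κ a ∈ Set.Icc (b - a) (κ * (b - a)) := by
  have hpos : ∀ c ∈ Set.Icc a b, 0 ≤ c := fun c hc => ha.trans hc.1
  have hcont : ContinuousOn (tailExponent κ) (Set.Icc a b) := fun c hc =>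
    (hasDerivAt_tailExponent hκ (hpos c hc)).continuousAt.continuousWithinAt
  have hdiff : DifferentiableOn ℝ (tailExponent κ) (interior (Set.Icc a b)) := fun c hc =>
    (hasDerivAt_tailExponent hκ (hpos c (interior_subset hc))).differentiableAt
      |>.differentiableWithinAt
  have hderiv : ∀ c ∈ interior (Set.Icc a b), deriv (tailExponent κ) c = tailSlope κ c :=
    fun c hc => (hasDerivAt_tailExponent hκ (hpos c (interior_subset hc))).deriv
  constructor
  · rw [← one_mul (b - a)]
    refine (convex_Icc a b).mul_sub_le_image_sub_of_le_deriv hcont hdiff (fun c hc => ?_) a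
      (Set.left_mem_Icc.2 hab) b (Set.right_mem_Icc.2 hab) hab
    exact (hderiv c hc).symm ▸ one_le_tailSlope hκ (hpos c (interior_subset hc))
  · refine (convex_Icc a b).image_sub_le_mul_sub_of_deriv_le hcont hdiff (fun c hc => ?_) a
      (Set.left_mem_Icc.2 hab) b (Set.right_mem_Icc.2 hab) hab
    exact (hderiv c hc).symm ▸ tailSlope_le hκ (hpos c (interior_subset hc))

lemma le_tailExponent (hκ : 1 ≤ κ) (ha : 0 ≤ a) : a ≤ tailExponent κ a := by
  simpa [tailExponent_zero (zero_le_one.trans hκ)] using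
    (tailExponent_sub_mem_Icc hκ le_rfl ha).1

lemma two_mul_sq_le_tailExponent (hκ : 1 ≤ κ) : 2 * κ ^ 2 ≤ tailExponent κ (3 * κ) := by
  have hR : 3 * κ ≤ √(κ ^ 2 - 1 + (1 + 3 * κ) ^ 2) := Real.le_sqrt_of_sq_le (by nlinarith)
  rw [tailExponent]
  nlinarith

end tailExponent

/-- The tail `P(|Z| > a)` of the light-tailed noise, for `0 ≤ a`. -/
def noiseTail (κ a : ℝ) : ℝ := Real.exp (1 - Real.exp (tailExponent κ a))

/-- The inverse of `noiseTail κ` on `(0, 1]`. -/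
def noiseTailInv (κ p : ℝ) : ℝ := tailExponentInv κ (Real.log (1 - Real.log p))

/-- The quantile function of the light-tailed noise. -/
def quantile (κ u : ℝ) : ℝ :=
  if u ≤ 1 / 2 then -noiseTailInv κ (2 * u) else noiseTailInv κ (2 - 2 * u)

/-- The distribution function of the light-tailed noise. -/
def noiseCdf (κ x : ℝ) : ℝ :=
  if x ≤ 0 then noiseTail κ (-x) / 2 else 1 - noiseTail κ x / 2

/-- The logarithm of the density of the light-tailed noise, as a function of the modulus. -/
def radialLogDensity (κ a : ℝ) : ℝ :=
  Real.log (tailSlope κ a) + tailExponent κ a + 1 - Real.exp (tailExponent κ a) - Real.log 2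

/-- The logarithm of the density of the light-tailed noise. -/
def logDensity (κ x : ℝ) : ℝ := radialLogDensity κ |x|

/-- The law of the light-tailed noise. -/
def noiseLaw (κ : ℝ) : Measure ℝ :=
  volume.withDensity fun x => ENNReal.ofReal (Real.exp (logDensity κ x))

section noiseLaw

variable {κ a p u x : ℝ}

lemma one_le_one_sub_log (hp : p ∈ Set.Ioc (0 : ℝ) 1) : 1 ≤ 1 - Real.log p := by
  linarith [Real.log_nonpos hp.1.le hp.2]

lemma noiseTailInv_nonneg (hp : p ∈ Set.Ioc (0 : ℝ) 1) : 0 ≤ noiseTailInv κ p :=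
  tailExponentInv_nonneg (Real.log_nonneg (one_le_one_sub_log hp))

lemma noiseTail_noiseTailInv (hκ : 0 < κ) (hp : p ∈ Set.Ioc (0 : ℝ) 1) :
    noiseTail κ (noiseTailInv κ p) = p := by
  have h := one_le_one_sub_log hp
  rw [noiseTail, noiseTailInv, tailExponent_tailExponentInv hκ (Real.log_nonneg h),
    Real.exp_log (by linarith), sub_sub_cancel, Real.exp_log hp.1]

lemma noiseTailInv_noiseTail (hκ : 1 ≤ κ) (ha : 0 ≤ a) :
    noiseTailInv κ (noiseTail κ a) = a := by
  rw [noiseTailInv, noiseTail, Real.log_exp, sub_sub_cancel, Real.log_exp,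
    tailExponentInv_tailExponent hκ ha]

lemma noiseTail_le_one (hκ : 1 ≤ κ) (ha : 0 ≤ a) : noiseTail κ a ≤ 1 :=
  Real.exp_le_one_iff.2 (sub_nonpos.2 (Real.one_le_exp (ha.trans (le_tailExponent hκ ha))))

lemma noiseTail_lt_one (hκ : 1 ≤ κ) (ha : 0 < a) : noiseTail κ a < 1 :=
  Real.exp_lt_one_iff.2 (sub_neg.2
    (Real.one_lt_exp_iff.2 (ha.trans_le (le_tailExponent hκ ha.le))))

lemma noiseTailInv_pos (hκ : 1 ≤ κ) (hp : p ∈ Set.Ioo (0 : ℝ) 1) : 0 < noiseTailInv κ p := by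
  have hp' : p ∈ Set.Ioc (0 : ℝ) 1 := ⟨hp.1, hp.2.le⟩
  refine (noiseTailInv_nonneg hp').lt_of_ne fun h => hp.2.ne ?_
  have hκ0 : 0 < κ := by linarith
  rw [← noiseTail_noiseTailInv hκ0 hp', ← h, noiseTail, tailExponent_zero hκ0.le, Real.exp_zero,
    sub_self, Real.exp_zero]

lemma noiseCdf_mem_Ioo (hκ : 1 ≤ κ) (x : ℝ) : noiseCdf κ x ∈ Set.Ioo (0 : ℝ) 1 := by
  have hpos (a : ℝ) : 0 < noiseTail κ a := Real.exp_pos _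
  unfold noiseCdf
  split_ifs with h
  · constructor <;> linarith [hpos (-x), noiseTail_le_one hκ (neg_nonneg.2 h)]
  · constructor <;> linarith [hpos x, noiseTail_le_one hκ (not_le.1 h).le]

lemma quantile_noiseCdf (hκ : 1 ≤ κ) (x : ℝ) : quantile κ (noiseCdf κ x) = x := by
  unfold noiseCdf
  split_ifs with h
  · have hle := noiseTail_le_one hκ (neg_nonneg.2 h)
    rw [quantile, if_pos (by linarith), mul_div_cancel₀ _ two_ne_zero,
      noiseTailInv_noiseTail hκ (neg_nonneg.2 h), neg_neg]
  · have hlt := noiseTail_lt_one hκ (not_le.1 h)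
    rw [quantile, if_neg (by linarith), mul_sub, mul_div_cancel₀ _ two_ne_zero, mul_one,
      sub_sub_cancel, noiseTailInv_noiseTail hκ (not_le.1 h).le]

lemma noiseCdf_quantile (hκ : 1 ≤ κ) (hu : u ∈ Set.Ioo (0 : ℝ) 1) :
    noiseCdf κ (quantile κ u) = u := by
  obtain ⟨h0, h1⟩ := hu
  have hκ0 : 0 < κ := by linarith
  unfold quantile
  split_ifs with h
  · have hp : 2 * u ∈ Set.Ioc (0 : ℝ) 1 := ⟨by linarith, by linarith⟩
    rw [noiseCdf, if_pos (neg_nonpos.2 (noiseTailInv_nonneg hp)), neg_neg,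
      noiseTail_noiseTailInv hκ0 hp, mul_div_cancel_left₀ _ two_ne_zero]
  · have hp : 2 - 2 * u ∈ Set.Ioo (0 : ℝ) 1 := ⟨by linarith, by linarith⟩
    rw [noiseCdf, if_neg (noiseTailInv_pos hκ hp).not_ge,
      noiseTail_noiseTailInv hκ0 ⟨hp.1, hp.2.le⟩]
    ring

lemma abs_quantile (hu : u ∈ Set.Ioo (0 : ℝ) 1) :
    |quantile κ u| = noiseTailInv κ (2 * min u (1 - u)) := by
  obtain ⟨h0, h1⟩ := hu
  unfold quantile
  split_ifs with h
  · rw [abs_neg, abs_of_nonneg (noiseTailInv_nonneg ⟨by linarith, by linarith⟩),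
      min_eq_left (by linarith)]
  · rw [abs_of_nonneg (noiseTailInv_nonneg ⟨by linarith, by linarith⟩),
      min_eq_right (by linarith), mul_sub, mul_one]

lemma noiseTail_abs_quantile (hκ : 0 < κ) (hu : u ∈ Set.Ioo (0 : ℝ) 1) :
    noiseTail κ |quantile κ u| = 2 * min u (1 - u) := by
  have hmin : 0 < min u (1 - u) := lt_min hu.1 (by linarith [hu.2])
  rw [abs_quantile hu, noiseTail_noiseTailInv hκ ⟨by linarith, ?_⟩]
  linarith [min_le_left u (1 - u), min_le_right u (1 - u)]

lemma exp_logDensity (hκ : 1 ≤ κ) (x : ℝ) : Real.exp (logDensity κ x) =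
    noiseTail κ |x| * Real.exp (tailExponent κ |x|) * tailSlope κ |x| / 2 := by
  have hslope : 0 < tailSlope κ |x| := zero_lt_one.trans_le (one_le_tailSlope hκ (abs_nonneg x))
  rw [logDensity, radialLogDensity, Real.exp_sub, Real.exp_log two_pos, add_sub_assoc,
    Real.exp_add, Real.exp_add, Real.exp_log hslope, noiseTail]
  ring

lemma hasDerivAt_noiseTail (hκ : 1 ≤ κ) (ha : 0 ≤ a) :
    HasDerivAt (noiseTail κ)
      (-(noiseTail κ a * Real.exp (tailExponent κ a) * tailSlope κ a)) a := by
  refine ((hasDerivAt_tailExponent hκ ha).exp.const_sub 1).exp.congr_deriv ?_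
  rw [noiseTail]
  ring

lemma hasDerivAt_noiseCdf (hκ : 1 ≤ κ) (hx : x ≠ 0) :
    HasDerivAt (noiseCdf κ) (Real.exp (logDensity κ x)) x := by
  rw [exp_logDensity hκ]
  rcases hx.lt_or_gt with h | h
  · have hd := ((hasDerivAt_noiseTail hκ (neg_nonneg.2 h.le)).comp x (hasDerivAt_neg x)).div_const 2
    rw [abs_of_neg h]
    refine (hd.congr_of_eventuallyEq ?_).congr_deriv (by ring)
    filter_upwards [Iio_mem_nhds h] with y hy
    exact if_pos (Set.mem_Iio.1 hy).le
  · have hd := ((hasDerivAt_noiseTail hκ h.le).div_const 2).const_sub 1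
    rw [abs_of_pos h]
    refine (hd.congr_of_eventuallyEq ?_).congr_deriv (by ring)
    filter_upwards [Ioi_mem_nhds h] with y hy
    exact if_neg (Set.mem_Ioi.1 hy).not_ge

lemma measurable_quantile (κ : ℝ) : Measurable (quantile κ) := by
  unfold quantile noiseTailInv tailExponentInv
  exact Measurable.ite measurableSet_Iic (by fun_prop) (by fun_prop)

lemma measurable_logDensity (κ : ℝ) : Measurable (logDensity κ) := by
  unfold logDensity radialLogDensity tailSlope tailExponent
  fun_prop

theorem map_quantile (hκ : 1 ≤ κ) :
    (volume.restrict (Set.Ioo (0 : ℝ) 1)).map (quantile κ) = noiseLaw κ := by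
  ext S hS
  have hpre : quantile κ ⁻¹' S ∩ Set.Ioo 0 1 = noiseCdf κ '' S := by
    ext u
    constructor
    · rintro ⟨hq, hu⟩
      exact ⟨_, hq, noiseCdf_quantile hκ hu⟩
    · rintro ⟨x, hx, rfl⟩
      exact ⟨by rwa [Set.mem_preimage, quantile_noiseCdf hκ], noiseCdf_mem_Ioo hκ x⟩
  have hinj : Function.Injective (noiseCdf κ) :=
    Function.LeftInverse.injective (quantile_noiseCdf hκ)
  have hS₀ : (S \ {0} : Set ℝ) =ᵐ[volume] S := sdiff_null_ae_eq_self Real.volume_singleton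
  have himage : (noiseCdf κ '' (S \ {0}) : Set ℝ) =ᵐ[volume] noiseCdf κ '' S := by
    rw [Set.image_sdiff hinj, Set.image_singleton]
    exact sdiff_null_ae_eq_self Real.volume_singleton
  rw [Measure.map_apply (measurable_quantile κ) hS,
    Measure.restrict_apply (measurable_quantile κ hS), noiseLaw, withDensity_apply _ hS,
    hpre, ← measure_congr himage, ← setLIntegral_one,
    lintegral_image_eq_lintegral_abs_deriv_mul (hS.diff (measurableSet_singleton 0))
      (fun x hx => (hasDerivAt_noiseCdf hκ hx.2).hasDerivWithinAt) hinj.injOn,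
    setLIntegral_congr hS₀]
  simp only [Real.abs_exp, mul_one]

lemma isProbabilityMeasure_noiseLaw (hκ : 1 ≤ κ) : IsProbabilityMeasure (noiseLaw κ) := by
  rw [← map_quantile hκ]
  have : IsProbabilityMeasure (volume.restrict (Set.Ioo (0 : ℝ) 1)) := ⟨by simp⟩
  exact Measure.isProbabilityMeasure_map (measurable_quantile κ).aemeasurable

end noiseLaw

lemma hasDerivAt_radialLogDensity {κ a : ℝ} (hκ : 1 ≤ κ) (ha : 0 ≤ a) :
    HasDerivAt (radialLogDensity κ) (1 / (1 + a) - (1 + a) / (κ ^ 2 - 1 + (1 + a) ^ 2) +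
      tailSlope κ a - Real.exp (tailExponent κ a) * tailSlope κ a) a := by
  have hrad := radicand_pos hκ ha
  have : 0 < κ := by linarith
  have hquad : HasDerivAt (fun a => κ ^ 2 - 1 + (1 + a) ^ 2) (2 * (1 + a)) a := by
    simpa using (((hasDerivAt_id a).const_add 1).pow 2).const_add (κ ^ 2 - 1)
  have hnum : HasDerivAt (fun a => κ * (1 + a)) κ a := by
    simpa using ((hasDerivAt_id a).const_add 1).const_mul κ
  have hlog : HasDerivAt (fun a => Real.log (tailSlope κ a))
      (1 / (1 + a) - (1 + a) / (κ ^ 2 - 1 + (1 + a) ^ 2)) a := by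
    have hR := Real.sq_sqrt hrad.le
    have hR0 := Real.sqrt_pos.2 hrad
    have hslope : tailSlope κ a ≠ 0 := (zero_lt_one.trans_le (one_le_tailSlope hκ ha)).ne'
    refine ((hnum.div (hquad.sqrt hrad.ne') hR0.ne').log hslope).congr_deriv ?_
    simp only [Pi.div_apply]
    generalize √(κ ^ 2 - 1 + (1 + a) ^ 2) = R at hR hR0 ⊢
    rw [← hR]
    field_simp
  have hφ := hasDerivAt_tailExponent hκ ha
  exact (((hlog.add hφ).add_const 1).sub hφ.exp).sub_const (Real.log 2)

lemma abs_deriv_radialLogDensity_le {κ a : ℝ} (hκ : 1 ≤ κ) (ha : 0 ≤ a) :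
    |deriv (radialLogDensity κ) a| ≤ Real.exp (tailExponent κ a) * tailSlope κ a := by
  have hrad := radicand_pos hκ ha
  have hlog : 1 / (1 + a) - (1 + a) / (κ ^ 2 - 1 + (1 + a) ^ 2) ∈ Set.Icc (0 : ℝ) 1 := by
    constructor
    · rw [sub_nonneg, div_le_div_iff₀ hrad (by linarith)]
      nlinarith
    · have : 1 / (1 + a) ≤ 1 := (div_le_one (by linarith)).2 (by linarith)
      have : 0 ≤ (1 + a) / (κ ^ 2 - 1 + (1 + a) ^ 2) := by positivity
      linarith
  have hslope := one_le_tailSlope hκ ha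
  have hexp := Real.one_le_exp (ha.trans (le_tailExponent hκ ha))
  rw [(hasDerivAt_radialLogDensity hκ ha).deriv, abs_le]
  constructor <;> nlinarith [hlog.1, hlog.2]

lemma exp_tailExponent_le_two_mul {κ a c s : ℝ} (hκ : 1 ≤ κ) (ha : 0 ≤ a) (hc : 0 ≤ c)
    (hca : c ≤ a + s) (hs : s * κ ≤ 1 / 8) :
    Real.exp (tailExponent κ c) ≤ 2 * Real.exp (tailExponent κ a) := by
  have hlog : 1 / 8 ≤ Real.log 2 := by linarith [Real.log_two_gt_d9]
  have hφ : tailExponent κ c ≤ Real.log 2 + tailExponent κ a := by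
    rcases le_total c a with h | h
    · linarith [(tailExponent_sub_mem_Icc hκ hc h).1]
    · nlinarith [(tailExponent_sub_mem_Icc hκ ha h).2]
  calc Real.exp (tailExponent κ c) ≤ Real.exp (Real.log 2 + tailExponent κ a) :=
        Real.exp_le_exp.2 hφ
    _ = 2 * Real.exp (tailExponent κ a) := by rw [Real.exp_add, Real.exp_log two_pos]

lemma tailSlope_le_exp_tailExponent {κ a : ℝ} (hκ : 1 ≤ κ) (ha : 0 ≤ a) :
    tailSlope κ a ≤ Real.exp (tailExponent κ a) :=
  calc tailSlope κ a ≤ tailExponent κ a + 1 := by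
        linarith [tailSlope_le_one_add hκ ha, le_tailExponent hκ ha]
    _ ≤ _ := Real.add_one_le_exp _

/-! ### The privacy loss of the light-tailed noise -/

/-- The privacy loss of the light-tailed noise at `x`, for the shift `v`. -/
def loss (κ v x : ℝ) : ℝ := logDensity κ x - logDensity κ (x - v)

section loss

variable {κ l s v : ℝ}

lemma measurable_loss (κ v : ℝ) : Measurable (loss κ v) := by
  have := measurable_logDensity κ
  unfold loss
  fun_prop

lemma abs_loss_le (hκ : 1 ≤ κ) (hv : |v| ≤ s) (hs : s * κ ≤ 1 / 8) (x : ℝ) :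
    |loss κ v x| ≤ 2 * Real.exp (tailExponent κ |x|) *
      min κ (2 * Real.exp (tailExponent κ |x|)) * s := by
  set T := Real.exp (tailExponent κ |x|)
  have hshift : |(|x| - |x - v|)| ≤ s := by
    have := abs_abs_sub_abs_le_abs_sub x (x - v)
    rw [sub_sub_cancel] at this
    exact this.trans hv
  have hconv : Convex ℝ (Set.Icc 0 (|x| + s)) := convex_Icc _ _
  have hmem : |x| ∈ Set.Icc 0 (|x| + s) := ⟨abs_nonneg x, by linarith [(abs_nonneg v).trans hv]⟩
  have hmem' : |x - v| ∈ Set.Icc 0 (|x| + s) := ⟨abs_nonneg _, by linarith [(abs_le.1 hshift).1]⟩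
  have hderiv : ∀ c ∈ Set.Icc 0 (|x| + s),
      ‖deriv (radialLogDensity κ) c‖ ≤ 2 * T * min κ (2 * T) := by
    intro c hc
    have hT := exp_tailExponent_le_two_mul hκ (abs_nonneg x) hc.1 hc.2 hs
    have hslope : tailSlope κ c ≤ min κ (2 * T) :=
      le_min (tailSlope_le hκ hc.1) ((tailSlope_le_exp_tailExponent hκ hc.1).trans hT)
    calc _ ≤ Real.exp (tailExponent κ c) * tailSlope κ c := abs_deriv_radialLogDensity_le hκ hc.1
      _ ≤ _ := mul_le_mul hT hslope (zero_le_one.trans (one_le_tailSlope hκ hc.1)) (by positivity)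
  calc |loss κ v x| ≤ 2 * T * min κ (2 * T) * |(|x| - |x - v|)| :=
        hconv.norm_image_sub_le_of_norm_deriv_le
          (fun c hc => (hasDerivAt_radialLogDensity hκ hc.1).differentiableAt) hderiv hmem' hmem
    _ ≤ _ := by gcongr

lemma loss_sq_mul_exp_le (hκ : 1 ≤ κ) (hl : 1 ≤ l) (hv : |v| ≤ s) (hs : l * s * κ ≤ 1 / 8)
    (x : ℝ) : loss κ v x ^ 2 * Real.exp (l * |loss κ v x|) ≤
      98304 * s ^ 2 * Real.exp (Real.exp (tailExponent κ |x|) / 2) := by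
  have hs0 : 0 ≤ s := (abs_nonneg _).trans hv
  have hloss := abs_loss_le hκ hv
    ((by nlinarith [mul_nonneg hs0 (zero_le_one.trans hκ)] : s * κ ≤ l * s * κ).trans hs) x
  set T := Real.exp (tailExponent κ |x|)
  have hT : 0 < T := Real.exp_pos _
  have hlin : l * |loss κ v x| ≤ T / 4 := by
    have : |loss κ v x| ≤ 2 * T * κ * s := hloss.trans (by gcongr; exact min_le_left _ _)
    nlinarith
  have hquad : |loss κ v x| ≤ 4 * s * T ^ 2 := by
    have : |loss κ v x| ≤ 2 * T * (2 * T) * s := hloss.trans (by gcongr; exact min_le_right _ _)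
    linarith
  have hpow : T ^ 4 ≤ 6144 * Real.exp (T / 4) := by
    have := Real.pow_div_factorial_le_exp (T / 4) (by positivity) 4
    norm_num [Nat.factorial] at this
    ring_nf at this ⊢
    linarith
  calc loss κ v x ^ 2 * Real.exp (l * |loss κ v x|)
      = |loss κ v x| ^ 2 * Real.exp (l * |loss κ v x|) := by rw [sq_abs]
    _ ≤ (4 * s * T ^ 2) ^ 2 * Real.exp (T / 4) := by gcongr
    _ = 16 * s ^ 2 * T ^ 4 * Real.exp (T / 4) := by ring
    _ ≤ 16 * s ^ 2 * (6144 * Real.exp (T / 4)) * Real.exp (T / 4) := by gcongr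
    _ = 98304 * s ^ 2 * Real.exp (T / 2) := by
      rw [show T / 2 = T / 4 + T / 4 by ring, Real.exp_add]
      ring

end loss

lemma exp_le_one_add_add_sq_mul_exp (y : ℝ) : Real.exp y ≤ 1 + y + y ^ 2 * Real.exp |y| := by
  have h := Complex.norm_exp_sub_sum_le_norm_mul_exp (y : ℂ) 2
  have hsum : Complex.exp y - ∑ m ∈ Finset.range 2, (y : ℂ) ^ m / (m.factorial : ℂ) =
      ((Real.exp y - (1 + y) : ℝ) : ℂ) := by simp [Finset.sum_range_succ]
  rw [hsum, Complex.norm_real, Complex.norm_real, Real.norm_eq_abs, Real.norm_eq_abs,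
    sq_abs] at h
  linarith [le_abs_self (Real.exp y - (1 + y))]

lemma exp_mul_add_mul_exp_neg_le {l : ℝ} (hl : 1 ≤ l) (y : ℝ) :
    Real.exp (l * y) + l * Real.exp (-y) ≤ 1 + l + 2 * l ^ 2 * (y ^ 2 * Real.exp (l * |y|)) := by
  have hpos := exp_le_one_add_add_sq_mul_exp (l * y)
  have hneg := exp_le_one_add_add_sq_mul_exp (-y)
  rw [abs_mul, abs_of_nonneg (zero_le_one.trans hl)] at hpos
  rw [abs_neg, neg_sq] at hneg
  have hexp : Real.exp |y| ≤ Real.exp (l * |y|) :=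
    Real.exp_le_exp.2 (le_mul_of_one_le_left (abs_nonneg y) hl)
  have hsq : l * (y ^ 2 * Real.exp |y|) ≤ l ^ 2 * (y ^ 2 * Real.exp (l * |y|)) := by
    gcongr
    nlinarith
  nlinarith [mul_le_mul_of_nonneg_left hneg (zero_le_one.trans hl)]

lemma lintegral_rpow_neg_half :
    ∫⁻ u in Set.Ioo (0 : ℝ) 1, ENNReal.ofReal (u ^ (-(1 / 2) : ℝ)) = 2 := by
  have hint : IntervalIntegrable (fun x : ℝ => x ^ (-(1 / 2) : ℝ)) volume 0 1 :=
    intervalIntegral.intervalIntegrable_rpow' (by norm_num)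
  rw [intervalIntegrable_iff_integrableOn_Ioo_of_le zero_le_one] at hint
  rw [← ofReal_integral_eq_lintegral_ofReal hint, ← integral_Ioc_eq_integral_Ioo,
    ← intervalIntegral.integral_of_le zero_le_one, integral_rpow (Or.inl (by norm_num))]
  · norm_num
  · filter_upwards [ae_restrict_mem measurableSet_Ioo] with u hu
    exact Real.rpow_nonneg hu.1.le _

lemma lintegral_one_sub_rpow_neg_half :
    ∫⁻ u in Set.Ioo (0 : ℝ) 1, ENNReal.ofReal ((1 - u) ^ (-(1 / 2) : ℝ)) = 2 := by
  have hreflect : (fun u : ℝ => 1 - u) ⁻¹' Set.Ioo 0 1 = Set.Ioo 0 1 := by simp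
  have hmp := (volume.measurePreserving_sub_left (1 : ℝ)).restrict_preimage
    (measurableSet_Ioo (a := 0) (b := 1))
  rw [hreflect] at hmp
  exact (hmp.lintegral_comp (f := fun u => ENNReal.ofReal (u ^ (-(1 / 2) : ℝ)))
    (by fun_prop)).trans lintegral_rpow_neg_half

section loss

variable {κ l s v : ℝ}

lemma exp_half_exp_tailExponent_quantile_le (hκ : 0 < κ) {u : ℝ} (hu : u ∈ Set.Ioo (0 : ℝ) 1) :
    Real.exp (Real.exp (tailExponent κ |quantile κ u|) / 2) ≤
      2 * (u ^ (-(1 / 2) : ℝ) + (1 - u) ^ (-(1 / 2) : ℝ)) := by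
  set m := min u (1 - u)
  have h1u : 0 < 1 - u := by linarith [hu.2]
  have hm : 0 < m := lt_min hu.1 h1u
  have htail : Real.exp (tailExponent κ |quantile κ u|) = 1 - Real.log (2 * m) := by
    rw [← noiseTail_abs_quantile hκ hu, noiseTail, Real.log_exp, sub_sub_cancel]
  have hle : Real.exp (Real.exp (tailExponent κ |quantile κ u|) / 2) ≤
      2 * m ^ (-(1 / 2) : ℝ) := by
    rw [htail, Real.rpow_def_of_pos hm, ← Real.le_log_iff_exp_le (by positivity),
      Real.log_mul two_ne_zero (Real.exp_ne_zero _), Real.log_exp,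
      Real.log_mul two_ne_zero hm.ne']
    linarith [Real.log_two_gt_d9]
  have hu0 : 0 ≤ u ^ (-(1 / 2) : ℝ) := Real.rpow_nonneg hu.1.le _
  have h1u0 : 0 ≤ (1 - u) ^ (-(1 / 2) : ℝ) := Real.rpow_nonneg h1u.le _
  rcases min_choice u (1 - u) with h | h <;> rw [show m = _ from h] at hle <;> linarith

lemma lintegral_exp_half_exp_tailExponent_le (hκ : 1 ≤ κ) :
    ∫⁻ x, ENNReal.ofReal (Real.exp (Real.exp (tailExponent κ |x|) / 2)) ∂noiseLaw κ ≤ 8 := by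
  have hm : Measurable fun x : ℝ =>
      ENNReal.ofReal (Real.exp (Real.exp (tailExponent κ |x|) / 2)) := by
    unfold tailExponent
    fun_prop
  rw [← map_quantile hκ, lintegral_map hm (measurable_quantile κ)]
  calc _ ≤ ∫⁻ u in Set.Ioo (0 : ℝ) 1, 2 * (ENNReal.ofReal (u ^ (-(1 / 2) : ℝ)) +
        ENNReal.ofReal ((1 - u) ^ (-(1 / 2) : ℝ))) := by
        refine setLIntegral_mono (by fun_prop) fun u hu => ?_
        have h1u : 0 ≤ 1 - u := by linarith [hu.2]
        rw [← ENNReal.ofReal_add (Real.rpow_nonneg hu.1.le _) (Real.rpow_nonneg h1u _),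
          ← ENNReal.ofReal_ofNat 2, ← ENNReal.ofReal_mul zero_le_two]
        exact ENNReal.ofReal_le_ofReal
          (exp_half_exp_tailExponent_quantile_le (zero_lt_one.trans_le hκ) hu)
    _ = 8 := by
        rw [lintegral_const_mul _ (by fun_prop), lintegral_add_left (by fun_prop),
          lintegral_rpow_neg_half, lintegral_one_sub_rpow_neg_half]
        norm_num

end loss

lemma map_add_right_withDensity {G : Type*} [AddGroup G] [MeasurableSpace G] [MeasurableAdd G]
    (μ : Measure G) [μ.IsAddRightInvariant] (f : G → ENNReal) (v : G) :
    (μ.withDensity f).map (· + v) = μ.withDensity fun x => f (x - v) := by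
  ext S hS
  have hpre : MeasurableSet ((· + v) ⁻¹' S) := measurable_add_const v hS
  rw [Measure.map_apply (measurable_add_const v) hS, withDensity_apply _ hpre,
    withDensity_apply _ hS, ← (measurePreserving_add_right μ v).setLIntegral_comp_preimage_emb
      (measurableEmbedding_addRight v) (fun x => f (x - v))]
  simp only [add_sub_cancel_right]

section pi

variable {ι : Type*} [Fintype ι] {X : ι → Type*} [∀ i, MeasurableSpace (X i)]
  (μ : ∀ i, Measure (X i)) [∀ i, IsProbabilityMeasure (μ i)] {f : ∀ i, X i → ENNReal}

lemma lintegral_pi_prod (hf : ∀ i, Measurable (f i)) :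
    ∫⁻ x, ∏ i, f i (x i) ∂Measure.pi μ = ∏ i, ∫⁻ y, f i y ∂μ i := by
  have hind : iIndepFun (fun i (x : ∀ i, X i) => f i (x i)) (Measure.pi μ) :=
    iIndepFun_pi fun i => (hf i).aemeasurable
  rw [lintegral_prod_eq_prod_lintegral_of_indepFun Finset.univ _ hind fun i =>
    (hf i).comp (measurable_pi_apply i)]
  exact Finset.prod_congr rfl fun i _ => (measurePreserving_eval μ i).lintegral_comp (hf i)

lemma pi_withDensity [∀ i, SigmaFinite ((μ i).withDensity (f i))] (hf : ∀ i, Measurable (f i)) :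
    Measure.pi (fun i => (μ i).withDensity (f i)) =
      (Measure.pi μ).withDensity fun x => ∏ i, f i (x i) := by
  refine Measure.pi_eq fun S hS => ?_
  have hind : (Set.univ.pi S).indicator (fun x => ∏ i, f i (x i)) =
      fun x => ∏ i, (S i).indicator (f i) (x i) := by
    classical
    ext x
    simp only [Set.indicator_apply, Set.mem_univ_pi, Finset.prod_ite_zero, Finset.mem_univ,
      true_imp_iff]
  rw [withDensity_apply _ (MeasurableSet.univ_pi hS),
    ← lintegral_indicator (MeasurableSet.univ_pi hS), hind,
    lintegral_pi_prod μ fun i => (hf i).indicator (hS i)]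
  exact Finset.prod_congr rfl fun i _ => by
    rw [lintegral_indicator (hS i), withDensity_apply _ (hS i)]

end pi

/-- The first term suffices where the privacy loss `Λ` is at most `ε`; elsewhere
`1 ≤ exp (l * (Λ x - ε))`. -/
theorem measure_le_exp_mul_withDensity_add {X : Type*} [MeasurableSpace X] (μ : Measure X)
    {Λ : X → ℝ} (hΛ : Measurable Λ) {l : ℝ} (hl : 0 ≤ l) (ε : ℝ) {A : Set X}
    (hA : MeasurableSet A) :
    μ A ≤ ENNReal.ofReal (Real.exp ε) *
        (μ.withDensity fun x => ENNReal.ofReal (Real.exp (-Λ x))) A +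
      ENNReal.ofReal (Real.exp (-(l * ε))) * ∫⁻ x, ENNReal.ofReal (Real.exp (l * Λ x)) ∂μ := by
  have hpt (x : X) : 1 ≤ ENNReal.ofReal (Real.exp ε) * ENNReal.ofReal (Real.exp (-Λ x)) +
      ENNReal.ofReal (Real.exp (-(l * ε))) * ENNReal.ofReal (Real.exp (l * Λ x)) := by
    simp only [← ENNReal.ofReal_mul (Real.exp_pos _).le, ← Real.exp_add]
    rcases le_total (Λ x) ε with h | h
    · exact le_add_right (ENNReal.one_le_ofReal.2 (Real.one_le_exp (by linarith)))
    · exact le_add_left (ENNReal.one_le_ofReal.2 (Real.one_le_exp (by nlinarith)))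
  calc μ A = ∫⁻ _ in A, 1 ∂μ := (setLIntegral_one A).symm
    _ ≤ ∫⁻ x in A, (ENNReal.ofReal (Real.exp ε) * ENNReal.ofReal (Real.exp (-Λ x)) +
        ENNReal.ofReal (Real.exp (-(l * ε))) * ENNReal.ofReal (Real.exp (l * Λ x))) ∂μ :=
      lintegral_mono hpt
    _ = ENNReal.ofReal (Real.exp ε) * ∫⁻ x in A, ENNReal.ofReal (Real.exp (-Λ x)) ∂μ +
        ENNReal.ofReal (Real.exp (-(l * ε))) *
          ∫⁻ x in A, ENNReal.ofReal (Real.exp (l * Λ x)) ∂μ := by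
      rw [lintegral_add_left (by fun_prop), lintegral_const_mul _ (by fun_prop),
        lintegral_const_mul _ (by fun_prop)]
    _ ≤ _ := by
      rw [withDensity_apply _ hA]
      exact add_le_add le_rfl (mul_le_mul_right (setLIntegral_le_lintegral _ _) _)

/-- Moving the noise law `ν` by a vector of norm at most `s` is `(ε, δ)`-indistinguishable: adding
noise with law `ν` to a statistic of sensitivity `s` is `(ε, δ)`-differentially private. -/
def IsShiftPrivate {E : Type*} [SeminormedAddCommGroup E] [MeasurableSpace E] (ν : Measure E)
    (s ε δ : ℝ) : Prop :=
  ∀ v : E, ‖v‖ ≤ s → ∀ A : Set E, MeasurableSet A →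
    ν A ≤ ENNReal.ofReal (Real.exp ε) * ν ((· + v) ⁻¹' A) + ENNReal.ofReal δ

section loss

variable {κ l s v : ℝ}

lemma map_add_noiseLaw (κ v : ℝ) : (noiseLaw κ).map (· + v) =
    (noiseLaw κ).withDensity fun x => ENNReal.ofReal (Real.exp (-loss κ v x)) := by
  have := measurable_logDensity κ
  have := measurable_loss κ v
  rw [noiseLaw, map_add_right_withDensity, ← withDensity_mul _ (by fun_prop) (by fun_prop)]
  congr with x
  rw [Pi.mul_apply, ← ENNReal.ofReal_mul (Real.exp_pos _).le, ← Real.exp_add, loss, neg_sub,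
    add_sub_cancel]

lemma lintegral_exp_neg_loss (hκ : 1 ≤ κ) (v : ℝ) :
    ∫⁻ x, ENNReal.ofReal (Real.exp (-loss κ v x)) ∂noiseLaw κ = 1 := by
  have := isProbabilityMeasure_noiseLaw hκ
  have : IsProbabilityMeasure ((noiseLaw κ).map (· + v)) :=
    Measure.isProbabilityMeasure_map (by fun_prop)
  rw [← setLIntegral_univ, ← withDensity_apply _ MeasurableSet.univ, ← map_add_noiseLaw,
    measure_univ]

theorem lintegral_exp_mul_loss_le (hκ : 1 ≤ κ) (hl : 1 ≤ l) (hv : |v| ≤ s)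
    (hs : l * s * κ ≤ 1 / 8) :
    ∫⁻ x, ENNReal.ofReal (Real.exp (l * loss κ v x)) ∂noiseLaw κ ≤
      ENNReal.ofReal (Real.exp (2000000 * (l * s) ^ 2)) := by
  have := isProbabilityMeasure_noiseLaw hκ
  have hm := measurable_loss κ v
  have hl0 : 0 ≤ l := by linarith
  have hpt (x : ℝ) : ENNReal.ofReal (Real.exp (l * loss κ v x)) +
      ENNReal.ofReal l * ENNReal.ofReal (Real.exp (-loss κ v x)) ≤
      ENNReal.ofReal (1 + l) + ENNReal.ofReal (196608 * (l * s) ^ 2) *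
        ENNReal.ofReal (Real.exp (Real.exp (tailExponent κ |x|) / 2)) := by
    rw [← ENNReal.ofReal_mul hl0, ← ENNReal.ofReal_mul (by positivity),
      ← ENNReal.ofReal_add (by positivity) (by positivity),
      ← ENNReal.ofReal_add (by positivity) (by positivity)]
    refine ENNReal.ofReal_le_ofReal ((exp_mul_add_mul_exp_neg_le hl (loss κ v x)).trans ?_)
    linarith [mul_le_mul_of_nonneg_left (loss_sq_mul_exp_le hκ hl hv hs x)
      (by positivity : 0 ≤ 2 * l ^ 2)]
  have hsum : (∫⁻ x, ENNReal.ofReal (Real.exp (l * loss κ v x)) ∂noiseLaw κ) +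
      ENNReal.ofReal l ≤ ENNReal.ofReal (Real.exp (2000000 * (l * s) ^ 2)) + ENNReal.ofReal l := by
    calc _ = ∫⁻ x, (ENNReal.ofReal (Real.exp (l * loss κ v x)) +
          ENNReal.ofReal l * ENNReal.ofReal (Real.exp (-loss κ v x))) ∂noiseLaw κ := by
          rw [lintegral_add_left (by fun_prop), lintegral_const_mul _ (by fun_prop),
            lintegral_exp_neg_loss hκ, mul_one]
      _ ≤ _ := lintegral_mono hpt
      _ = ENNReal.ofReal (1 + l) + ENNReal.ofReal (196608 * (l * s) ^ 2) *
          ∫⁻ x, ENNReal.ofReal (Real.exp (Real.exp (tailExponent κ |x|) / 2)) ∂noiseLaw κ := by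
          rw [lintegral_add_left measurable_const, lintegral_const, measure_univ, mul_one,
            lintegral_const_mul' _ _ ENNReal.ofReal_ne_top]
      _ ≤ ENNReal.ofReal (1 + l) + ENNReal.ofReal (196608 * (l * s) ^ 2) * ENNReal.ofReal 8 := by
          rw [ENNReal.ofReal_ofNat]
          gcongr
          exact lintegral_exp_half_exp_tailExponent_le hκ
      _ ≤ _ := by
          rw [← ENNReal.ofReal_mul (by positivity), ← ENNReal.ofReal_add (by positivity)
            (by positivity), ← ENNReal.ofReal_add (Real.exp_pos _).le hl0]
          refine ENNReal.ofReal_le_ofReal ?_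
          linarith [Real.add_one_le_exp (2000000 * (l * s) ^ 2), sq_nonneg (l * s)]
  exact (ENNReal.add_le_add_iff_right ENNReal.ofReal_ne_top).1 hsum

lemma map_add_pi_noiseLaw {ι : Type*} [Fintype ι] (hκ : 1 ≤ κ) (v : ι → ℝ) :
    (Measure.pi fun _ : ι => noiseLaw κ).map (· + v) =
      (Measure.pi fun _ : ι => noiseLaw κ).withDensity
        fun x => ENNReal.ofReal (Real.exp (-∑ j, loss κ (v j) (x j))) := by
  have hm := fun j => measurable_loss κ (v j)
  have := isProbabilityMeasure_noiseLaw hκ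
  have hprob (j : ι) : IsProbabilityMeasure ((noiseLaw κ).map (· + v j)) :=
    Measure.isProbabilityMeasure_map (by fun_prop)
  have hmap := Measure.pi_map_pi (μ := fun _ : ι => noiseLaw κ) (f := fun j x => x + v j)
    fun j => by fun_prop
  simp only [map_add_noiseLaw] at hprob hmap
  refine hmap.trans ((pi_withDensity _ fun j => by fun_prop).trans ?_)
  congr with x
  rw [← ENNReal.ofReal_prod_of_nonneg fun j _ => (Real.exp_pos _).le, ← Real.exp_sum,
    Finset.sum_neg_distrib]

theorem isShiftPrivate_pi_noiseLaw {ι : Type*} [Fintype ι] (hκ : 1 ≤ κ) (hl : 1 ≤ l)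
    (hs : l * s * κ ≤ 1 / 8) (ε : ℝ) :
    IsShiftPrivate (Measure.pi fun _ : ι => noiseLaw κ) s ε
      (Real.exp (Fintype.card ι * (2000000 * (l * s) ^ 2) - l * ε)) := by
  intro v hv A hA
  have hm := fun j => measurable_loss κ (v j)
  have := isProbabilityMeasure_noiseLaw hκ
  set μ := Measure.pi fun _ : ι => noiseLaw κ
  have hmoment : ∫⁻ x, ENNReal.ofReal (Real.exp (l * ∑ j, loss κ (v j) (x j))) ∂μ ≤
      ENNReal.ofReal (Real.exp (Fintype.card ι * (2000000 * (l * s) ^ 2))) := by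
    calc _ = ∏ j, ∫⁻ y, ENNReal.ofReal (Real.exp (l * loss κ (v j) y)) ∂noiseLaw κ := by
          rw [← lintegral_pi_prod _ fun j => by fun_prop]
          refine lintegral_congr fun x => ?_
          rw [← ENNReal.ofReal_prod_of_nonneg fun j _ => (Real.exp_pos _).le, ← Real.exp_sum,
            Finset.mul_sum]
      _ ≤ ∏ _ : ι, ENNReal.ofReal (Real.exp (2000000 * (l * s) ^ 2)) :=
          Finset.prod_le_prod' fun j _ =>
            lintegral_exp_mul_loss_le hκ hl ((norm_le_pi_norm v j).trans hv) hs
      _ = _ := by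
          rw [Finset.prod_const, Finset.card_univ, Real.exp_nat_mul,
            ENNReal.ofReal_pow (Real.exp_pos _).le]
  calc μ A ≤ ENNReal.ofReal (Real.exp ε) * μ.map (· + v) A + ENNReal.ofReal (Real.exp (-(l * ε))) *
        ∫⁻ x, ENNReal.ofReal (Real.exp (l * ∑ j, loss κ (v j) (x j))) ∂μ := by
        rw [map_add_pi_noiseLaw hκ]
        exact measure_le_exp_mul_withDensity_add μ (by fun_prop) (zero_le_one.trans hl) ε hA
    _ ≤ ENNReal.ofReal (Real.exp ε) * μ ((· + v) ⁻¹' A) + ENNReal.ofReal (Real.exp (-(l * ε))) *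
        ENNReal.ofReal (Real.exp (Fintype.card ι * (2000000 * (l * s) ^ 2))) := by
        rw [Measure.map_apply (measurable_add_const v) hA]
        gcongr
    _ = _ := by
        rw [← ENNReal.ofReal_mul (Real.exp_pos _).le, ← Real.exp_add, neg_add_eq_sub]

end loss

/-! ### The cube noise -/

/-- The open unit cube in `ℝ^ι`. -/
def openCube (ι : Type*) : Set (ι → ℝ) := Set.univ.pi fun _ => Set.Ioo 0 1

lemma measurableSet_openCube {ι : Type*} [Countable ι] : MeasurableSet (openCube ι) :=
  MeasurableSet.univ_pi fun _ => measurableSet_Ioo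

section cube

variable {ι : Type*} [Fintype ι] {r : ℝ}

/-- The law of two independent uniform points of the unit cube. -/
def cubePairLaw (ι : Type*) [Fintype ι] : Measure ((ι → ℝ) × (ι → ℝ)) :=
  volume.restrict (openCube ι ×ˢ openCube ι)

/-- The cube noise: for a pair `(U, V)` of uniform points of the unit cube, a uniform point of the
cube with centre `0` and random half-width `r / ‖U‖`. -/
def cubeNoise (r : ℝ) (z : (ι → ℝ) × (ι → ℝ)) : ι → ℝ := (r / ‖z.1‖) • ((2 : ℝ) • z.2 - 1)

lemma volume_openCube : volume (openCube ι) = 1 := by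
  rw [openCube, volume_pi_pi]
  simp

instance : IsProbabilityMeasure (cubePairLaw ι) := by
  refine ⟨?_⟩
  rw [cubePairLaw, Measure.restrict_apply_univ, Measure.volume_eq_prod, Measure.prod_prod,
    volume_openCube, one_mul]

lemma measurable_cubeNoise (r : ℝ) : Measurable (cubeNoise (ι := ι) r) := by
  unfold cubeNoise
  fun_prop

/-- The law of the cube noise. -/
def cubeNoiseLaw (ι : Type*) [Fintype ι] (r : ℝ) : Measure (ι → ℝ) :=
  (cubePairLaw ι).map (cubeNoise r)

lemma norm_pos_of_mem_openCube [Nonempty ι] {U : ι → ℝ} (hU : U ∈ openCube ι) : 0 < ‖U‖ :=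
  norm_pos_iff.2 fun h => by
    have := (hU (Classical.arbitrary ι) trivial).1
    simp [h] at this

lemma norm_lt_one_of_mem_openCube {U : ι → ℝ} (hU : U ∈ openCube ι) : ‖U‖ < 1 :=
  (pi_norm_lt_iff one_pos).2 fun i => by
    rw [Real.norm_eq_abs, abs_lt]
    constructor <;> linarith [(hU i trivial).1, (hU i trivial).2]

/-- The shear which, followed by a contraction with ratio `(1 + s / r)⁻¹`, moves the cube noise
by `b`. -/
def cubeShear (r s : ℝ) (b : ι → ℝ) (z : (ι → ℝ) × (ι → ℝ)) : (ι → ℝ) × (ι → ℝ) :=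
  (z.1, z.2 + fun j => (s + b j * ‖z.1‖) / (2 * r))

lemma measurePreserving_cubeShear (r s : ℝ) (b : ι → ℝ) :
    MeasurePreserving (cubeShear r s b) := by
  refine MeasurePreserving.skew_product
    (g := fun U V => V + fun j => (s + b j * ‖U‖) / (2 * r)) (.id _) (by fun_prop) ?_
  exact .of_forall fun U => (measurePreserving_add_right volume _).map_eq

variable {s : ℝ} {b : ι → ℝ} {z : (ι → ℝ) × (ι → ℝ)}

lemma inv_smul_cubeShear_mem (hr : 0 < r) (hb : ‖b‖ ≤ s) (hz : z ∈ openCube ι ×ˢ openCube ι) :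
    (1 + s / r)⁻¹ • cubeShear r s b z ∈ openCube ι ×ˢ openCube ι := by
  have hs : 0 ≤ s / r := div_nonneg ((norm_nonneg b).trans hb) hr.le
  have hU := norm_lt_one_of_mem_openCube hz.1
  refine ⟨fun j _ => ?_, fun j _ => ?_⟩
  · obtain ⟨h0, h1⟩ := hz.1 j trivial
    simp only [cubeShear, Prod.smul_mk, Pi.smul_apply, smul_eq_mul]
    exact ⟨by positivity, (inv_mul_lt_iff₀ (by positivity)).2 (by linarith)⟩
  · obtain ⟨h0, h1⟩ := hz.2 j trivial
    have hbj : |b j * ‖z.1‖| ≤ s := by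
      rw [abs_mul, abs_norm]
      exact (mul_le_of_le_one_right (abs_nonneg _) hU.le).trans ((norm_le_pi_norm b j).trans hb)
    obtain ⟨hlo, hhi⟩ := abs_le.1 hbj
    have hg0 : 0 ≤ (s + b j * ‖z.1‖) / (2 * r) := div_nonneg (by linarith) (by positivity)
    have hg1 : (s + b j * ‖z.1‖) / (2 * r) ≤ s / r := by
      rw [← mul_div_mul_left s r two_ne_zero]
      gcongr
      linarith
    simp only [cubeShear, Prod.smul_mk, Pi.smul_apply, Pi.add_apply, smul_eq_mul]
    exact ⟨by positivity, (inv_mul_lt_iff₀ (by positivity)).2 (by linarith)⟩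

lemma cubeNoise_inv_smul_cubeShear [Nonempty ι] (hr : 0 < r) (hs : 0 ≤ s)
    (hz : z.1 ∈ openCube ι) :
    cubeNoise r ((1 + s / r)⁻¹ • cubeShear r s b z) = b + cubeNoise r z := by
  have hU := norm_pos_of_mem_openCube hz
  ext j
  simp only [cubeNoise, cubeShear, Prod.smul_mk, norm_smul, Pi.smul_apply, Pi.add_apply,
    Pi.sub_apply, Pi.one_apply, smul_eq_mul]
  rw [Real.norm_of_nonneg (by positivity)]
  field_simp
  ring

theorem isShiftPrivate_cubeNoiseLaw [Nonempty ι] {ε : ℝ} (hr : 0 < r)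
    (hε : 2 * Fintype.card ι * (s / r) ≤ ε) : IsShiftPrivate (cubeNoiseLaw ι r) s ε 0 := by
  intro v hv A hA
  have hs : 0 ≤ s := (norm_nonneg v).trans hv
  have hm := measurable_cubeNoise (ι := ι) r
  set Q := openCube ι ×ˢ openCube ι
  have hQ : MeasurableSet Q := measurableSet_openCube.prod measurableSet_openCube
  set θ := 1 + s / r
  have hθ : 0 < θ := by positivity
  set S := (fun z => cubeNoise r z + v) ⁻¹' A ∩ Q
  have hS : MeasurableSet S := ((hm.add_const v) hA).inter hQ
  have hsub : cubeNoise r ⁻¹' A ∩ Q ⊆ cubeShear r s (-v) ⁻¹' ((θ⁻¹ • ·) ⁻¹' S) := by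
    rintro z ⟨hzA, hz⟩
    refine ⟨?_, inv_smul_cubeShear_mem hr (by rwa [norm_neg]) hz⟩
    change cubeNoise r (θ⁻¹ • cubeShear r s (-v) z) + v ∈ A
    rwa [cubeNoise_inv_smul_cubeShear hr hs hz.1, neg_add_cancel_comm]
  have hfinrank : Module.finrank ℝ ((ι → ℝ) × (ι → ℝ)) = 2 * Fintype.card ι := by
    rw [Module.finrank_prod, Module.finrank_fintype_fun_eq_card, two_mul]
  have hθε : θ ^ (2 * Fintype.card ι) ≤ Real.exp ε := by
    calc θ ^ (2 * Fintype.card ι) ≤ Real.exp (s / r) ^ (2 * Fintype.card ι) := by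
          gcongr
          linarith [Real.add_one_le_exp (s / r)]
      _ = Real.exp (2 * Fintype.card ι * (s / r)) := by rw [← Real.exp_nat_mul]; push_cast; rfl
      _ ≤ Real.exp ε := Real.exp_le_exp.2 hε
  rw [cubeNoiseLaw, Measure.map_apply hm hA, Measure.map_apply hm (measurable_add_const v hA),
    cubePairLaw, Measure.restrict_apply' hQ, Measure.restrict_apply' hQ, ENNReal.ofReal_zero,
    add_zero]
  calc _ ≤ volume (cubeShear r s (-v) ⁻¹' ((θ⁻¹ • ·) ⁻¹' S)) := measure_mono hsub
    _ = volume ((θ⁻¹ • ·) ⁻¹' S) :=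
      (measurePreserving_cubeShear r s _).measure_preimage
        (measurable_const_smul θ⁻¹ hS).nullMeasurableSet
    _ = ENNReal.ofReal (θ ^ (2 * Fintype.card ι)) * volume S := by
      have : (volume : Measure ((ι → ℝ) × (ι → ℝ))).IsAddHaarMeasure :=
        Measure.prod.instIsAddHaarMeasure _ _
      rw [Measure.addHaar_preimage_smul _ (inv_ne_zero hθ.ne'), hfinrank,
        inv_pow, inv_inv, abs_of_pos (by positivity)]
    _ ≤ _ := by gcongr; rfl

lemma norm_cubeNoise_lt [Nonempty ι] (hr : 0 < r) (hz : z ∈ openCube ι ×ˢ openCube ι) :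
    ‖cubeNoise r z‖ < r / ‖z.1‖ := by
  have hU := norm_pos_of_mem_openCube hz.1
  rw [cubeNoise, norm_smul, Real.norm_of_nonneg (by positivity)]
  refine mul_lt_of_lt_one_right (by positivity) ((pi_norm_lt_iff one_pos).2 fun j => ?_)
  obtain ⟨h0, h1⟩ := hz.2 j trivial
  rw [Real.norm_eq_abs, abs_lt]
  simp only [Pi.sub_apply, Pi.smul_apply, smul_eq_mul, Pi.one_apply]
  constructor <;> linarith

theorem cubeNoiseLaw_le_norm_le [Nonempty ι] (hr : 0 < r) {t : ℝ} (ht : 0 < t) :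
    cubeNoiseLaw ι r {x | t ≤ ‖x‖} ≤ ENNReal.ofReal ((r / t) ^ Fintype.card ι) := by
  have hsub : {z | t ≤ ‖cubeNoise r z‖} ∩ openCube ι ×ˢ openCube ι ⊆
      (Set.univ.pi fun _ => Set.Ioo 0 (r / t)) ×ˢ openCube ι := by
    rintro z ⟨hzt, hz⟩
    have hU := norm_pos_of_mem_openCube hz.1
    have hlt : ‖z.1‖ < r / t := by
      have := hzt.trans_lt (norm_cubeNoise_lt hr hz)
      rwa [lt_div_comm₀ ht hU] at this
    exact ⟨fun j _ => ⟨(hz.1 j trivial).1,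
      (le_abs_self _).trans_lt ((norm_le_pi_norm z.1 j).trans_lt hlt)⟩, hz.2⟩
  rw [cubeNoiseLaw, Measure.map_apply (measurable_cubeNoise r) (by measurability), cubePairLaw,
    Measure.restrict_apply' (measurableSet_openCube.prod measurableSet_openCube)]
  calc _ ≤ _ := measure_mono hsub
    _ = _ := by
      rw [Measure.volume_eq_prod, Measure.prod_prod, volume_openCube, mul_one, volume_pi_pi,
        Finset.prod_const, Real.volume_Ioo, sub_zero, Finset.card_univ,
        ENNReal.ofReal_pow (by positivity)]

end cube

lemma IsShiftPrivate.mono {E : Type*} [SeminormedAddCommGroup E] [MeasurableSpace E]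
    {ν : Measure E} {s ε ε' δ δ' : ℝ} (hν : IsShiftPrivate ν s ε δ) (hε : ε ≤ ε') (hδ : δ ≤ δ') :
    IsShiftPrivate ν s ε' δ' := fun v hv A hA => (hν v hv A hA).trans (by gcongr)

lemma IsShiftPrivate.map_smul {E : Type*} [NormedAddCommGroup E] [NormedSpace ℝ E]
    [MeasurableSpace E] [BorelSpace E] {ν : Measure E} {s ε δ c : ℝ}
    (hν : IsShiftPrivate ν (s / c) ε δ) (hc : 0 < c) :
    IsShiftPrivate (ν.map (c • ·)) s ε δ := by
  intro v hv A hA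
  have hm : Measurable fun x : E => c • x := by fun_prop
  have hpre : (c • ·) ⁻¹' ((· + v) ⁻¹' A) = (· + c⁻¹ • v) ⁻¹' ((c • ·) ⁻¹' A) := by
    ext x
    simp only [Set.mem_preimage, smul_add, smul_inv_smul₀ hc.ne']
  have hv' : ‖c⁻¹ • v‖ ≤ s / c := by
    rw [norm_smul, norm_inv, Real.norm_of_nonneg hc.le, inv_mul_eq_div]
    gcongr
  rw [Measure.map_apply hm hA, Measure.map_apply hm ?_, hpre]
  · exact hν _ hv' _ (hm hA)
  · exact (continuous_add_const v).measurable hA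

section tail

variable {ι : Type*} [Fintype ι] {κ a : ℝ}

lemma noiseLaw_le_abs_le (hκ : 1 ≤ κ) (ha : 0 ≤ a) :
    noiseLaw κ {x | a ≤ |x|} ≤ ENNReal.ofReal (noiseTail κ a) := by
  set p := noiseTail κ a with hp
  have hsub : quantile κ ⁻¹' {x | a ≤ |x|} ∩ Set.Ioo 0 1 ⊆
      Set.Icc 0 (p / 2) ∪ Set.Icc (1 - p / 2) 1 := by
    rintro u ⟨(hua : a ≤ |quantile κ u|), hu⟩
    have hmono := (tailExponent_sub_mem_Icc hκ ha hua).1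
    have hmin : 2 * min u (1 - u) ≤ p := by
      rw [← noiseTail_abs_quantile (zero_lt_one.trans_le hκ) hu, hp, noiseTail, noiseTail]
      gcongr
      linarith [sub_nonneg.2 hua]
    rcases min_cases u (1 - u) with ⟨h, -⟩ | ⟨h, -⟩ <;> rw [h] at hmin
    · exact Or.inl ⟨hu.1.le, by linarith⟩
    · exact Or.inr ⟨by linarith, hu.2.le⟩
  rw [← map_quantile hκ, Measure.map_apply (measurable_quantile κ) (by measurability),
    Measure.restrict_apply' measurableSet_Ioo]
  calc _ ≤ volume (Set.Icc 0 (p / 2)) + volume (Set.Icc (1 - p / 2) 1) :=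
        (measure_mono hsub).trans (measure_union_le _ _)
    _ = ENNReal.ofReal p := by
        have hp0 : 0 ≤ p := (Real.exp_pos _).le
        rw [Real.volume_Icc, Real.volume_Icc, ← ENNReal.ofReal_add (by linarith) (by linarith)]
        ring_nf

/-- The law of light-tailed noise of scale `c` in every coordinate, with independent
coordinates. -/
def productNoiseLaw (ι : Type*) [Fintype ι] (κ c : ℝ) : Measure (ι → ℝ) :=
  (Measure.pi fun _ : ι => noiseLaw κ).map (c • ·)

theorem productNoiseLaw_le_norm_le (hκ : 1 ≤ κ) {c : ℝ} (hc : 0 < c) (ha : 0 < a) :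
    productNoiseLaw ι κ c {x | a ≤ ‖x‖} ≤
      ENNReal.ofReal (Fintype.card ι * noiseTail κ (a / c)) := by
  have := isProbabilityMeasure_noiseLaw hκ
  have hac : 0 < a / c := by positivity
  have hsub : {x : ι → ℝ | a ≤ ‖c • x‖} ⊆ ⋃ j, Function.eval j ⁻¹' {y | a / c ≤ |y|} := by
    intro x hx
    rw [Set.mem_ofPred_eq, norm_smul, Real.norm_of_nonneg hc.le, ← div_le_iff₀' hc] at hx
    by_contra! hlt
    simp only [Set.mem_iUnion, Set.mem_preimage, Set.mem_ofPred_eq, Function.eval, not_exists,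
      not_le] at hlt
    exact hx.not_gt ((pi_norm_lt_iff hac).2 hlt)
  rw [productNoiseLaw, Measure.map_apply (by fun_prop) (by measurability)]
  calc _ ≤ ∑ j, (Measure.pi fun _ : ι => noiseLaw κ) (Function.eval j ⁻¹' {y | a / c ≤ |y|}) :=
        (measure_mono hsub).trans (measure_iUnion_fintype_le _ _)
    _ = ∑ _ : ι, noiseLaw κ {y | a / c ≤ |y|} :=
        Finset.sum_congr rfl fun j _ =>
          (measurePreserving_eval (fun _ : ι => noiseLaw κ) j).measure_preimage
            (by measurability)
    _ ≤ ∑ _ : ι, ENNReal.ofReal (noiseTail κ (a / c)) :=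
        Finset.sum_le_sum fun _ _ => noiseLaw_le_abs_le hκ hac.le
    _ = _ := by
        rw [Finset.sum_const, Finset.card_univ, nsmul_eq_mul, ENNReal.ofReal_mul (by positivity),
          ENNReal.ofReal_natCast]

end tail

instance : IsProbabilityMeasure randomnessLaw := by unfold randomnessLaw; infer_instance

/-- The uniform draws with indices in the range of `e`, as real numbers. -/
def uniforms {ι : Type*} (e : ι → ℕ) (ω : Randomness) : ι → ℝ := fun i => ω.1 (e i)

lemma measurable_uniforms {ι : Type*} (e : ι → ℕ) : Measurable (uniforms e) := by
  unfold uniforms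
  fun_prop

lemma map_coe_unitInterval :
    (volume : Measure unitInterval).map Subtype.val = volume.restrict (Set.Ioo (0 : ℝ) 1) := by
  rw [unitInterval.measurePreserving_coe.map_eq]
  exact Measure.restrict_congr_set Ioo_ae_eq_Icc.symm

lemma map_uniforms {ι : Type*} [Fintype ι] {e : ι → ℕ} (he : Function.Injective e) :
    randomnessLaw.map (uniforms e) =
      Measure.pi fun _ : ι => volume.restrict (Set.Ioo (0 : ℝ) 1) := by
  set μ := Measure.infinitePi fun _ : ℕ => (volume : Measure unitInterval)
  have hfst : randomnessLaw.map (uniforms e) = μ.map (fun x i => (x (e i) : ℝ)) := by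
    rw [← (measurePreserving_fst (μ := μ)
      (ν := Measure.infinitePi fun _ : ℕ => gaussianReal 0 1)).map_eq,
      Measure.map_map (by fun_prop) (by fun_prop)]
    rfl
  have hindep : iIndepFun (fun i (x : ℕ → unitInterval) => (x (e i) : ℝ)) μ :=
    (iIndepFun_infinitePi (X := fun (_ : ℕ) (x : unitInterval) => (x : ℝ))
      fun _ => measurable_subtype_coe).precomp he
  have hmeas (i : ι) : Measurable fun x : ℕ → unitInterval => (x (e i) : ℝ) :=
    measurable_subtype_coe.comp (measurable_pi_apply (e i))
  rw [hfst, (iIndepFun_iff_map_fun_eq_pi_map fun i => (hmeas i).aemeasurable).1 hindep]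
  congr with i : 1
  rw [← map_coe_unitInterval, ← (measurePreserving_eval_infinitePi
    (fun _ : ℕ => (volume : Measure unitInterval)) (e i)).map_eq,
    Measure.map_map (by fun_prop) (by fun_prop)]
  rfl

/-- Cube noise of scale `r` computed from the first `2 d` uniform draws. -/
def cubeNoiseDraw (d : ℕ) (r : ℝ) (ω : Randomness) : Fin d → ℝ :=
  cubeNoise r (uniforms (fun i : Fin d => d + i) ω, uniforms (fun j : Fin d => (j : ℕ)) ω)

/-- Product noise of scale `c` computed from the first `d` uniform draws. -/
def productNoiseDraw (d : ℕ) (κ c : ℝ) (ω : Randomness) : Fin d → ℝ :=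
  c • fun j => quantile κ (uniforms (fun j : Fin d => (j : ℕ)) ω j)

lemma measurable_cubeNoiseDraw (d : ℕ) (r : ℝ) : Measurable (cubeNoiseDraw d r) :=
  (measurable_cubeNoise r).comp ((measurable_uniforms _).prodMk (measurable_uniforms _))

lemma measurable_productNoiseDraw (d : ℕ) (κ c : ℝ) : Measurable (productNoiseDraw d κ c) := by
  have := measurable_quantile κ
  have := measurable_uniforms fun j : Fin d => (j : ℕ)
  unfold productNoiseDraw
  fun_prop

lemma map_cubeNoiseDraw (d : ℕ) (r : ℝ) :
    randomnessLaw.map (cubeNoiseDraw d r) = cubeNoiseLaw (Fin d) r := by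
  set e : Fin d ⊕ Fin d → ℕ := Sum.elim (fun i => d + i) (fun j => j)
  have he : Function.Injective e := by
    rintro (a | a) (b | b) h <;> simp only [e, Sum.elim_inl, Sum.elim_inr] at h <;>
      first | omega | (congr; omega)
  have hpi : cubePairLaw (Fin d) =
      (Measure.pi fun _ : Fin d => volume.restrict (Set.Ioo (0 : ℝ) 1)).prod
        (Measure.pi fun _ : Fin d => volume.restrict (Set.Ioo (0 : ℝ) 1)) := by
    rw [← Measure.restrict_pi_pi, Measure.prod_restrict]
    rfl
  have h := measurePreserving_sumPiEquivProdPi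
    (fun _ : Fin d ⊕ Fin d => volume.restrict (Set.Ioo (0 : ℝ) 1))
  rw [cubeNoiseLaw, hpi, ← h.map_eq, ← map_uniforms he,
    Measure.map_map (by fun_prop) (measurable_uniforms e),
    Measure.map_map (measurable_cubeNoise r) (h.measurable.comp (measurable_uniforms e))]
  rfl

lemma map_productNoiseDraw (d : ℕ) {κ : ℝ} (hκ : 1 ≤ κ) (c : ℝ) :
    randomnessLaw.map (productNoiseDraw d κ c) = productNoiseLaw (Fin d) κ c := by
  have hq := measurable_quantile κ
  have := isProbabilityMeasure_noiseLaw hκ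
  have : SigmaFinite ((volume.restrict (Set.Ioo (0 : ℝ) 1)).map (quantile κ)) := by
    rw [map_quantile hκ]
    infer_instance
  have hu := measurable_uniforms fun j : Fin d => (j : ℕ)
  rw [productNoiseLaw, ← map_quantile hκ, ← Measure.pi_map_pi fun _ => hq.aemeasurable,
    ← map_uniforms Fin.val_injective, Measure.map_map (by fun_prop) (by fun_prop),
    Measure.map_map (by fun_prop) (by fun_prop)]
  rfl

/-! ### The mechanism -/

section mechanism

variable {n d : ℕ}

/-- The projection of `ℝ^d` onto the cube. -/
def clip (x : Fin d → ℝ) : Cube d := fun j => Set.projIcc (-1) 1 (by norm_num) (x j)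

/-- The mechanism that adds noise with law `ν` to the marginals and projects onto the cube. -/
def noiseMechanism (n : ℕ) (ν : ProbabilityMeasure (Fin d → ℝ)) : Mechanism n d := fun D =>
  ν.map (f := fun x => clip (marginals D + x)) (by unfold clip; fun_prop)

lemma measurable_clip : Measurable (clip (d := d)) :=
  measurable_pi_lambda _ fun j => continuous_projIcc.measurable.comp (measurable_pi_apply j)

lemma measurable_toReal : Measurable (Cube.toReal (d := d)) :=
  measurable_pi_lambda _ fun j => measurable_subtype_coe.comp (measurable_pi_apply j)

lemma noiseMechanism_apply (ν : ProbabilityMeasure (Fin d → ℝ)) (D : Database n d)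
    {S : Set (Cube d)} (hS : MeasurableSet S) :
    (noiseMechanism n ν D : Measure (Cube d)) S =
      (ν : Measure (Fin d → ℝ)) {x | clip (marginals D + x) ∈ S} :=
  Measure.map_apply (measurable_clip.comp (measurable_const_add _)) hS

lemma implements_noiseMechanism {P : Program} {ε δ α : ℝ} {N : Randomness → Fin d → ℝ}
    {ν : ProbabilityMeasure (Fin d → ℝ)} (hN : Measurable N) (hν : randomnessLaw.map N = ν)
    (hP : ∀ (D : Database n d) ω, P.output ε δ α D ω = (clip (marginals D + N ω)).toReal) :
    P.Implements ε δ α (noiseMechanism n ν) := by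
  intro D
  have hm : Measurable fun x => clip (marginals D + x) :=
    measurable_clip.comp (measurable_const_add _)
  have hout : P.output ε δ α D = Cube.toReal ∘ (fun x => clip (marginals D + x)) ∘ N :=
    funext (hP D)
  rw [hout]
  refine ⟨measurable_toReal.comp (hm.comp hN), ?_⟩
  rw [← Measure.map_map measurable_toReal (hm.comp hN), ← Measure.map_map hm hN, hν]
  rfl

lemma norm_marginals_le (hn : 1 ≤ n) (D : Database n d) : ‖marginals D‖ ≤ 1 := by
  have hn' : (0 : ℝ) < n := by exact_mod_cast hn
  refine (pi_norm_le_iff_of_nonneg zero_le_one).2 fun j => ?_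
  have hentry (i : Fin n) : |(((D i j : ℤˣ) : ℤ) : ℝ)| = 1 := by
    rcases Int.units_eq_one_or (D i j) with h | h <;> simp [h]
  rw [marginals, Real.norm_eq_abs, abs_mul, abs_of_pos (by positivity), one_div,
    inv_mul_le_iff₀ hn', mul_one]
  exact (Finset.abs_sum_le_sum_abs _ _).trans_eq (by simp [hentry])

lemma norm_marginals_sub_le {D D' : Database n d} (h : Adjacent D D') :
    ‖marginals D - marginals D'‖ ≤ 2 / n := by
  obtain ⟨i, hi⟩ := h
  refine (pi_norm_le_iff_of_nonneg (by positivity)).2 fun j => ?_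
  have hsub : marginals D j - marginals D' j =
      1 / (n : ℝ) * ((((D i j : ℤˣ) : ℤ) : ℝ) - (((D' i j : ℤˣ) : ℤ) : ℝ)) := by
    rw [marginals, marginals, ← mul_sub, ← Finset.sum_sub_distrib,
      Finset.sum_eq_single i (fun k _ hk => by rw [hi k hk, sub_self]) (by simp)]
  rw [Pi.sub_apply, hsub, Real.norm_eq_abs, abs_mul, abs_of_nonneg (by positivity), one_div,
    div_eq_inv_mul]
  gcongr
  rcases Int.units_eq_one_or (D i j) with h | h <;>
    rcases Int.units_eq_one_or (D' i j) with h' | h' <;> norm_num [h, h']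

theorem isDP_noiseMechanism {ν : ProbabilityMeasure (Fin d → ℝ)} {ε δ : ℝ} (hδ : 0 ≤ δ)
    (hν : IsShiftPrivate (ν : Measure (Fin d → ℝ)) (2 / n) ε δ) :
    IsDP ε δ (noiseMechanism n ν) := by
  intro D D' hD S hS
  have hpre : (· + (marginals D' - marginals D)) ⁻¹' {x | clip (marginals D + x) ∈ S} =
      {x | clip (marginals D' + x) ∈ S} := by
    ext x
    rw [Set.mem_preimage, Set.mem_ofPred_eq, Set.mem_ofPred_eq, add_left_comm, add_sub_cancel,
      add_comm]
  have h := hν (marginals D' - marginals D) (by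
    rw [norm_sub_rev]
    exact norm_marginals_sub_le hD) {x | clip (marginals D + x) ∈ S}
    (measurable_clip.comp (measurable_const_add _) hS)
  rw [hpre, ← noiseMechanism_apply ν D hS, ← noiseMechanism_apply ν D' hS] at h
  have hreal := ENNReal.toReal_mono (by finiteness) h
  rwa [ENNReal.toReal_add (by finiteness) (by finiteness), ENNReal.toReal_mul,
    ENNReal.toReal_ofReal (Real.exp_pos _).le, ENNReal.toReal_ofReal hδ] at hreal

lemma norm_clip_add_sub_le (hn : 1 ≤ n) (D : Database n d) (x : Fin d → ℝ) :
    ‖(clip (marginals D + x)).toReal - marginals D‖ ≤ ‖x‖ := by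
  refine (pi_norm_le_iff_of_nonneg (norm_nonneg x)).2 fun j => ?_
  have hmem : marginals D j ∈ Set.Icc (-1 : ℝ) 1 :=
    abs_le.1 ((norm_le_pi_norm (marginals D) j).trans (norm_marginals_le hn D))
  calc ‖(clip (marginals D + x)).toReal j - marginals D j‖
      = |(Set.projIcc (-1 : ℝ) 1 (by norm_num) (marginals D j + x j) : ℝ) -
          Set.projIcc (-1 : ℝ) 1 (by norm_num) (marginals D j)| := by
        rw [Set.projIcc_of_mem _ hmem]
        rfl
    _ ≤ |marginals D j + x j - marginals D j| := Set.abs_projIcc_sub_projIcc _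
    _ ≤ ‖x‖ := by
        rw [add_sub_cancel_left]
        exact norm_le_pi_norm x j

theorem noiseMechanism_le_norm_sub_le (hn : 1 ≤ n) {ν : ProbabilityMeasure (Fin d → ℝ)}
    {α β : ℝ} (hβ : 0 ≤ β) (hν : (ν : Measure (Fin d → ℝ)) {x | α ≤ ‖x‖} ≤ ENNReal.ofReal β)
    (D : Database n d) :
    (noiseMechanism n ν D : Measure (Cube d)).real {y | α ≤ ‖y.toReal - marginals D‖} ≤ β := by
  rw [measureReal_def, noiseMechanism_apply ν D
    (measurableSet_le measurable_const ((measurable_toReal.sub_const _).norm))]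
  exact ENNReal.toReal_le_of_le_ofReal hβ ((measure_mono fun x hx =>
    hx.trans (norm_clip_add_sub_le hn D x)).trans hν)

end mechanism

/-- The noise that is added to the marginals: the product noise, unless the dimension is too small
compared to `log (1 / δ)` for its privacy loss to concentrate. -/
def marginalNoise (d : ℕ) (δ α : ℝ) : Randomness → Fin d → ℝ :=
  if (d : ℝ) ≤ (1 + Real.log (1 / δ)) * Real.log (Real.log d) then cubeNoiseDraw d (α / 3)
  else productNoiseDraw d √(Real.log (Real.log d)) (α / (3 * √(Real.log (Real.log d))))

lemma measurable_marginalNoise (d : ℕ) (δ α : ℝ) : Measurable (marginalNoise d δ α) := by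
  unfold marginalNoise
  split_ifs
  exacts [measurable_cubeNoiseDraw _ _, measurable_productNoiseDraw _ _ _]

/-- The law of the noise that is added to the marginals. -/
def marginalNoiseLaw (d : ℕ) (δ α : ℝ) : ProbabilityMeasure (Fin d → ℝ) :=
  ⟨randomnessLaw.map (marginalNoise d δ α),
    Measure.isProbabilityMeasure_map (measurable_marginalNoise d δ α).aemeasurable⟩

/-- The mechanism of the theorem. If `log (log d) ≤ 1`, then the sample bound may be void, so that
no noise is small enough; the exponent in the accuracy bound is then not positive. -/
def marginalMechanism (n d : ℕ) (δ α : ℝ) : Mechanism n d :=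
  if Real.log (Real.log d) ≤ 1 then fun _ => ⟨Measure.dirac (clip 0), inferInstance⟩
  else noiseMechanism n (marginalNoiseLaw d δ α)

lemma marginalMechanism_of_le {n d : ℕ} {δ α : ℝ} (hL : Real.log (Real.log d) ≤ 1) :
    marginalMechanism n d δ α = fun _ => ⟨Measure.dirac (clip 0), inferInstance⟩ :=
  if_pos hL

lemma marginalMechanism_of_lt {n d : ℕ} {δ α : ℝ} (hL : 1 < Real.log (Real.log d)) :
    marginalMechanism n d δ α = noiseMechanism n (marginalNoiseLaw d δ α) :=
  if_neg hL.not_ge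

lemma marginalNoiseLaw_eq_cubeNoiseLaw {d : ℕ} {δ α : ℝ}
    (hd : (d : ℝ) ≤ (1 + Real.log (1 / δ)) * Real.log (Real.log d)) :
    (marginalNoiseLaw d δ α : Measure (Fin d → ℝ)) = cubeNoiseLaw (Fin d) (α / 3) := by
  have hnoise : marginalNoise d δ α = cubeNoiseDraw d (α / 3) := if_pos hd
  rw [← map_cubeNoiseDraw, ← hnoise]
  rfl

lemma marginalNoiseLaw_eq_productNoiseLaw {d : ℕ} {δ α : ℝ} (hL : 1 < Real.log (Real.log d))
    (hd : (1 + Real.log (1 / δ)) * Real.log (Real.log d) < d) :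
    (marginalNoiseLaw d δ α : Measure (Fin d → ℝ)) =
      productNoiseLaw (Fin d) √(Real.log (Real.log d)) (α / (3 * √(Real.log (Real.log d)))) := by
  have hnoise : marginalNoise d δ α = productNoiseDraw d √(Real.log (Real.log d))
      (α / (3 * √(Real.log (Real.log d)))) := if_neg hd.not_ge
  rw [← map_productNoiseDraw d (Real.one_le_sqrt.2 hL.le), ← hnoise]
  rfl

lemma pos_of_one_lt_log_log {d : ℕ} (hL : 1 < Real.log (Real.log d)) : 0 < d := by
  rw [pos_iff_ne_zero]
  rintro rfl
  norm_num at hL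

/-- The exponential moment of order `2 (1 + log (1 / δ)) / ε` of the privacy loss is used. -/
lemma isShiftPrivate_productNoiseLaw {ι : Type*} [Fintype ι] {κ c s ε δ : ℝ} (hκ : 1 ≤ κ)
    (hc : 0 < c) (hs : 0 ≤ s) (hε : 0 < ε) (hε1 : ε ≤ 1) (hδ : 0 < δ) (hδ1 : δ ≤ 1)
    (hcard : (1 + Real.log (1 / δ)) * κ ^ 2 ≤ Fintype.card ι)
    (hscale : 3000 * √(Fintype.card ι * (1 + Real.log (1 / δ))) * (s / c) ≤ ε) :
    IsShiftPrivate (productNoiseLaw ι κ c) s ε δ := by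
  set T := 1 + Real.log (1 / δ) with hT
  have hT1 : 1 ≤ T := le_add_of_nonneg_right (Real.log_nonneg (one_le_one_div hδ hδ1))
  have hl : 1 ≤ 2 * T / ε := by
    rw [one_le_div hε]
    linarith
  have hls : 2 * T / ε * (s / c) * κ ≤ 1 / 8 := by
    have hTκ : T * κ ≤ √(Fintype.card ι * T) := by
      refine Real.le_sqrt_of_sq_le ?_
      calc (T * κ) ^ 2 = T * κ ^ 2 * T := by ring
        _ ≤ Fintype.card ι * T := by gcongr
    calc 2 * T / ε * (s / c) * κ = 2 * (T * κ * (s / c)) / ε := by ring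
      _ ≤ 2 * (√(Fintype.card ι * T) * (s / c)) / ε := by gcongr
      _ ≤ 1 / 8 := by
        rw [div_le_iff₀ hε]
        linarith
  have hmoment : Fintype.card ι * (2000000 * (2 * T / ε * (s / c)) ^ 2) ≤ T := by
    calc Fintype.card ι * (2000000 * (2 * T / ε * (s / c)) ^ 2)
        = 8 / 9 * T * ((3000 ^ 2 * (Fintype.card ι * T) * (s / c) ^ 2) / ε ^ 2) := by
          field_simp
          ring
      _ = 8 / 9 * T * (3000 * √(Fintype.card ι * T) * (s / c) / ε) ^ 2 := by
          rw [div_pow _ ε, mul_pow, mul_pow, Real.sq_sqrt (by positivity)]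
      _ ≤ 8 / 9 * T * 1 ^ 2 := by
          gcongr
          exact (div_le_one hε).2 hscale
      _ ≤ T := by linarith
  refine IsShiftPrivate.map_smul ((isShiftPrivate_pi_noiseLaw hκ hl hls ε).mono le_rfl ?_) hc
  calc Real.exp (Fintype.card ι * (2000000 * (2 * T / ε * (s / c)) ^ 2) - 2 * T / ε * ε)
      ≤ Real.exp (Real.log δ) := by
        gcongr
        rw [div_mul_cancel₀ _ hε.ne']
        have : T = 1 - Real.log δ := by rw [hT, one_div, Real.log_inv, sub_eq_add_neg]
        linarith
    _ = δ := Real.exp_log hδ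

lemma isShiftPrivate_marginalNoiseLaw {n d : ℕ} {ε δ α : ℝ} (hn : 1 ≤ n) (hε : 0 < ε)
    (hε1 : ε ≤ 1) (hδ : 0 < δ) (hδ1 : δ ≤ 1) (hα : 0 < α) (hL : 1 < Real.log (Real.log d))
    (hsample : 20000 * √(d * (1 + Real.log (1 / δ)) * Real.log (Real.log d)) ≤ n * (ε * α)) :
    IsShiftPrivate (marginalNoiseLaw d δ α : Measure (Fin d → ℝ)) (2 / n) ε δ := by
  have hn0 : (0 : ℝ) < n := by exact_mod_cast hn
  have hd0 : 0 < d := pos_of_one_lt_log_log hL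
  have : Nonempty (Fin d) := ⟨⟨0, hd0⟩⟩
  have hT : 0 < 1 + Real.log (1 / δ) :=
    add_pos_of_pos_of_nonneg one_pos (Real.log_nonneg (one_le_one_div hδ hδ1))
  have hL0 : 0 < Real.log (Real.log d) := one_pos.trans hL
  rcases le_or_gt (d : ℝ) ((1 + Real.log (1 / δ)) * Real.log (Real.log d)) with hd | hd
  · rw [marginalNoiseLaw_eq_cubeNoiseLaw hd]
    refine (isShiftPrivate_cubeNoiseLaw (ι := Fin d) (by positivity) ?_).mono le_rfl hδ.le
    have hsqrt : (d : ℝ) ≤ √(d * (1 + Real.log (1 / δ)) * Real.log (Real.log d)) := by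
      refine Real.le_sqrt_of_sq_le ?_
      rw [sq, mul_assoc]
      gcongr
    calc 2 * Fintype.card (Fin d) * (2 / n / (α / 3)) = 12 * d / (n * α) := by
          rw [Fintype.card_fin]
          field_simp
          norm_num
      _ ≤ ε := by
          rw [div_le_iff₀ (by positivity)]
          linarith
  · rw [marginalNoiseLaw_eq_productNoiseLaw hL hd]
    refine isShiftPrivate_productNoiseLaw (Real.one_le_sqrt.2 hL.le) (by positivity)
      (by positivity) hε hε1 hδ hδ1 ?_ ?_
    · rw [Real.sq_sqrt hL0.le, Fintype.card_fin]
      exact hd.le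
    · rw [Real.sqrt_mul (by positivity)] at hsample
      rw [Fintype.card_fin]
      set R := √(d * (1 + Real.log (1 / δ)))
      set κ := √(Real.log (Real.log d))
      calc 3000 * R * (2 / n / (α / (3 * κ))) = 18000 * (R * κ) / (n * α) := by
            field_simp
            ring
        _ ≤ ε := by
            rw [div_le_iff₀ (by positivity)]
            linarith [show 0 ≤ R * κ by positivity]

lemma sq_le_exp {x : ℝ} (hx : 0 ≤ x) : x ^ 2 ≤ Real.exp x := by
  have hhalf : x ≤ Real.exp (x / 2) := by linarith [Real.two_mul_le_exp (x := x / 2)]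
  calc x ^ 2 ≤ Real.exp (x / 2) ^ 2 := by gcongr
    _ = Real.exp x := by rw [← Real.exp_nat_mul, Nat.cast_two, mul_div_cancel₀ _ two_ne_zero]

lemma one_div_rpow_log_sub {x : ℝ} (hx : 0 < x) (a : ℝ) :
    1 / x ^ (Real.log x - a) = Real.exp (a * Real.log x - Real.log x ^ 2) := by
  rw [one_div, ← Real.rpow_neg hx.le, Real.rpow_def_of_pos hx]
  ring_nf

lemma marginalNoiseLaw_le_norm_le {d : ℕ} {α : ℝ} (δ : ℝ) (hα : 0 < α)
    (hL : 1 < Real.log (Real.log d)) :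
    (marginalNoiseLaw d δ α : Measure (Fin d → ℝ)) {x | α ≤ ‖x‖} ≤
      ENNReal.ofReal (1 / (d : ℝ) ^ (Real.log d - 3)) := by
  have hd0 : 0 < d := pos_of_one_lt_log_log hL
  have hd0' : (0 : ℝ) < d := by exact_mod_cast hd0
  have : Nonempty (Fin d) := ⟨⟨0, hd0⟩⟩
  have hlog : 1 < Real.log d :=
    (Real.log_pos_iff (Real.log_natCast_nonneg d)).1 (one_pos.trans hL)
  rw [one_div_rpow_log_sub hd0']
  rcases le_or_gt (d : ℝ) ((1 + Real.log (1 / δ)) * Real.log (Real.log d)) with hd | hd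
  · rw [marginalNoiseLaw_eq_cubeNoiseLaw hd]
    refine (cubeNoiseLaw_le_norm_le (by positivity) hα).trans (ENNReal.ofReal_le_ofReal ?_)
    have hthird : α / 3 / α ≤ Real.exp (-1) := by
      rw [div_right_comm, div_self hα.ne', Real.exp_neg, one_div]
      exact inv_anti₀ (Real.exp_pos 1) (by linarith [Real.exp_one_lt_d9])
    calc (α / 3 / α) ^ Fintype.card (Fin d) ≤ Real.exp (-1) ^ Fintype.card (Fin d) := by gcongr
      _ = Real.exp (-d) := by rw [Fintype.card_fin, ← Real.exp_nat_mul, mul_neg_one]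
      _ ≤ Real.exp (3 * Real.log d - Real.log d ^ 2) := by
        have hsq : Real.log d ^ 2 ≤ d := (sq_le_exp (by linarith)).trans_eq (Real.exp_log hd0')
        gcongr
        linarith
  · rw [marginalNoiseLaw_eq_productNoiseLaw hL hd]
    set κ := √(Real.log (Real.log d)) with hκdef
    have hκ : 1 ≤ κ := Real.one_le_sqrt.2 hL.le
    refine (productNoiseLaw_le_norm_le hκ (by positivity) hα).trans (ENNReal.ofReal_le_ofReal ?_)
    have hexp : Real.exp (2 * κ ^ 2) = Real.log d ^ 2 := by
      rw [hκdef, Real.sq_sqrt (by linarith), ← Nat.cast_two, Real.exp_nat_mul,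
        Real.exp_log (by linarith)]
    calc Fintype.card (Fin d) * noiseTail κ (α / (α / (3 * κ)))
        = d * noiseTail κ (3 * κ) := by rw [Fintype.card_fin, div_div_cancel₀ hα.ne']
      _ ≤ d * Real.exp (1 - Real.exp (2 * κ ^ 2)) := by
        unfold noiseTail
        gcongr
        exact two_mul_sq_le_tailExponent hκ
      _ = Real.exp (Real.log d + (1 - Real.log d ^ 2)) := by
        rw [hexp, Real.exp_add, Real.exp_log hd0']
      _ ≤ Real.exp (3 * Real.log d - Real.log d ^ 2) := by
        gcongr
        linarith

lemma log_le_three {x : ℝ} (hx : 0 ≤ Real.log x) (hL : Real.log (Real.log x) ≤ 1) :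
    Real.log x ≤ 3 := by
  rcases hx.eq_or_lt with h | h
  · rw [← h]
    norm_num
  · exact ((Real.log_le_iff_le_exp h).1 hL).trans (by linarith [Real.exp_one_lt_d9])

theorem isDP_marginalMechanism {n d : ℕ} {ε δ α : ℝ} (hn : 1 ≤ n) (hε : 0 < ε)
    (hε1 : ε ≤ 1) (hδ : 0 < δ) (hδ1 : δ ≤ 1) (hα : 0 < α)
    (hsample : 20000 * √(d * (1 + Real.log (1 / δ)) * Real.log (Real.log d)) ≤ n * (ε * α)) :
    IsDP ε δ (marginalMechanism n d δ α) := by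
  by_cases hL : Real.log (Real.log d) ≤ 1
  · rw [marginalMechanism_of_le hL]
    intro D D' _ S _
    exact (le_mul_of_one_le_left measureReal_nonneg (Real.one_le_exp hε.le)).trans
      (le_add_of_nonneg_right hδ.le)
  · rw [marginalMechanism_of_lt (not_le.1 hL)]
    exact isDP_noiseMechanism hδ.le
      (isShiftPrivate_marginalNoiseLaw hn hε hε1 hδ hδ1 hα (not_le.1 hL) hsample)

theorem marginalMechanism_le_norm_sub_le {n d : ℕ} {α : ℝ} (hn : 1 ≤ n) (hd : 1 ≤ d) (δ : ℝ)
    (hα : 0 < α) (D : Database n d) :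
    (marginalMechanism n d δ α D : Measure (Cube d)).real {y | α ≤ ‖y.toReal - marginals D‖} ≤
      1 / (d : ℝ) ^ (Real.log d - 3) := by
  by_cases hL : Real.log (Real.log d) ≤ 1
  · have hd1 : (1 : ℝ) ≤ d := by exact_mod_cast hd
    refine measureReal_le_one.trans ((one_le_div (by positivity)).2 ?_)
    exact Real.rpow_le_one_of_one_le_of_nonpos hd1
      (sub_nonpos.2 (log_le_three (Real.log_natCast_nonneg d) hL))
  · rw [marginalMechanism_of_lt (not_le.1 hL)]
    exact noiseMechanism_le_norm_sub_le hn (by positivity)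
      (marginalNoiseLaw_le_norm_le δ hα (not_le.1 hL)) D

lemma IsDP.mono {n d : ℕ} {ε ε' δ : ℝ} {M : Mechanism n d} (hM : IsDP ε δ M) (hε : ε ≤ ε') :
    IsDP ε' δ M := fun D D' hD S hS =>
  (hM D D' hD S hS).trans (by gcongr)

/-- The constant of the sample bound. -/
def sampleConstant (ε₀ δ₀ : ℝ) : ℝ := 20000 * max 1 ε₀ * √(1 + 1 / |Real.log δ₀|)

lemma sampleConstant_pos (ε₀ δ₀ : ℝ) : 0 < sampleConstant ε₀ δ₀ := by
  unfold sampleConstant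
  positivity

lemma one_add_log_one_div_le {δ δ₀ : ℝ} (hδ : 0 < δ) (hδδ₀ : δ ≤ δ₀) (hδ₀ : δ₀ < 1) :
    1 + Real.log (1 / δ) ≤ (1 + 1 / |Real.log δ₀|) * Real.log (1 / δ) := by
  have hlog₀ : Real.log δ₀ < 0 := Real.log_neg (hδ.trans_le hδδ₀) hδ₀
  have hlog : Real.log δ ≤ Real.log δ₀ := Real.log_le_log hδ hδδ₀
  rw [one_div δ, Real.log_inv, abs_of_neg hlog₀, one_add_mul, add_comm, one_div_mul_eq_div]
  gcongr
  rw [one_le_div (by linarith)]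
  linarith

theorem isDP_marginalMechanism_of_sampleConstant {n d : ℕ} {ε ε₀ δ δ₀ α : ℝ} (hn : 1 ≤ n)
    (hε : 0 < ε) (hεε₀ : ε ≤ ε₀) (hδ : 0 < δ) (hδδ₀ : δ ≤ δ₀) (hδ₀ : δ₀ < 1) (hα : 0 < α)
    (hsample : sampleConstant ε₀ δ₀ *
      (√(d * Real.log (1 / δ) * Real.log (Real.log d)) / (ε * α)) ≤ n) :
    IsDP ε δ (marginalMechanism n d δ α) := by
  set F := max 1 ε₀ with hF
  have hF0 : 0 < F := one_pos.trans_le (le_max_left _ _)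
  have hεF : ε / F ≤ 1 := (div_le_one hF0).2 (hεε₀.trans (le_max_right _ _))
  have hlog : 0 ≤ Real.log (1 / δ) := Real.log_nonneg (one_le_one_div hδ (hδδ₀.trans hδ₀.le))
  set B := 1 + 1 / |Real.log δ₀| with hB
  have hsqrt : √(d * (1 + Real.log (1 / δ)) * Real.log (Real.log d)) ≤
      √B * √(d * Real.log (1 / δ) * Real.log (Real.log d)) := by
    rw [Real.sqrt_mul (x := d * (1 + Real.log (1 / δ))) (by positivity),
      Real.sqrt_mul (x := d * Real.log (1 / δ)) (by positivity), ← mul_assoc,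
      ← Real.sqrt_mul (x := B) (by positivity), mul_left_comm B]
    gcongr
    exact one_add_log_one_div_le hδ hδδ₀ hδ₀
  refine (isDP_marginalMechanism hn (div_pos hε hF0) hεF hδ (hδδ₀.trans hδ₀.le) hα ?_).mono
    (div_le_self hε.le (le_max_left _ _))
  rw [← mul_div_assoc, div_le_iff₀ (by positivity), sampleConstant, ← hF, ← hB] at hsample
  calc 20000 * √(d * (1 + Real.log (1 / δ)) * Real.log (Real.log d))
      ≤ 20000 * (√B * √(d * Real.log (1 / δ) * Real.log (Real.log d))) := by gcongr
    _ = 20000 * F * √B * √(d * Real.log (1 / δ) * Real.log (Real.log d)) / F := by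
      field_simp
    _ ≤ n * (ε * α) / F := by gcongr
    _ = n * (ε / F * α) := by ring

/-! ### The program -/

/-- A quantitative Hoare triple: from a memory that satisfies `p`, the program performs at most
`B` steps and ends in a memory that satisfies `q`. -/
def Triple (E : Env) (p : State → Prop) (P : Program) (B : ℕ) (q : State → Prop) : Prop :=
  ∀ σ, p σ → P.steps E σ ≤ B ∧ q (P.exec E σ)

section triple

variable {E : Env} {p q r : State → Prop} {s t : Program} {A B : ℕ}

lemma Triple.mono (h : Triple E p s A q) (hAB : A ≤ B) : Triple E p s B q := fun σ hσ =>
  ⟨(h σ hσ).1.trans hAB, (h σ hσ).2⟩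

lemma Triple.imp (h : Triple E p s A q) (hqr : ∀ σ, q σ → r σ) : Triple E p s A r := fun σ hσ =>
  ⟨(h σ hσ).1, hqr _ (h σ hσ).2⟩

lemma Triple.exists {ι : Type*} {f : ι → State → Prop} (h : ∀ i, Triple E (f i) s A q) :
    Triple E (fun σ => ∃ i, f i σ) s A q := fun σ ⟨i, hi⟩ => h i σ hi

lemma triple_skip (h : ∀ σ, p σ → q σ) : Triple E p .skip 1 q := fun σ hσ => ⟨le_rfl, h σ hσ⟩

lemma triple_setReal {a : ℕ} {i : NExpr} {x : RExpr}
    (h : ∀ σ, p σ → q (σ.setReal a (i.eval σ) (x.eval E σ))) :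
    Triple E p (.setReal a i x) (i.cost + x.cost + 1) q := fun σ hσ => ⟨le_rfl, h σ hσ⟩

lemma Triple.seq (hs : Triple E p s A q) (ht : Triple E q t B r) :
    Triple E p (.seq s t) (A + B) r := fun σ hσ =>
  have h := ht _ (hs σ hσ).2
  ⟨Nat.add_le_add (hs σ hσ).1 h.1, h.2⟩

lemma Triple.ifLE {x y : RExpr} (hs : Triple E (fun σ => p σ ∧ x.eval E σ ≤ y.eval E σ) s A q)
    (ht : Triple E (fun σ => p σ ∧ y.eval E σ < x.eval E σ) t B q) :
    Triple E p (.ifLE x y s t) (x.cost + y.cost + 1 + max A B) q := fun σ hσ => by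
  simp only [Program.steps, Program.exec]
  split_ifs with h
  · exact ⟨by gcongr; exact (hs σ ⟨hσ, h⟩).1.trans (le_max_left _ _), (hs σ ⟨hσ, h⟩).2⟩
  · have h' := ht σ ⟨hσ, not_le.1 h⟩
    exact ⟨by gcongr; exact h'.1.trans (le_max_right _ _), h'.2⟩

lemma Triple.loop {a N : ℕ} {e : NExpr} {I J : ℕ → State → Prop}
    (he : ∀ σ, I 0 σ → e.eval σ = N) (hJ : ∀ k σ, I k σ → J k (σ.setNat a k))
    (hs : ∀ k < N, Triple E (J k) s B (I (k + 1))) :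
    Triple E (I 0) (.loop a e s) (e.cost + 1 + N * (1 + B)) (I N) := fun σ hσ => by
  have hI : ∀ k ≤ N, I k (iter (fun l τ => s.exec E (τ.setNat a l)) k σ) := by
    intro k
    induction k with
    | zero => exact fun _ => hσ
    | succ k ih => exact fun hk => (hs k hk _ (hJ k _ (ih (Nat.le_of_succ_le hk)))).2
  simp only [Program.steps, Program.exec, he σ hσ]
  refine ⟨Nat.add_le_add_left ?_ _, hI N le_rfl⟩
  have hsteps : ∀ k ∈ Finset.range N, 1 + s.steps E
      ((iter (fun l τ => s.exec E (τ.setNat a l)) k σ).setNat a k) ≤ 1 + B := fun k hk => by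
    have hkN := Finset.mem_range.1 hk
    exact Nat.add_le_add_left (hs k hkN _ (hJ k _ (hI k hkN.le))).1 1
  simpa only [Finset.card_range, smul_eq_mul] using Finset.sum_le_card_nsmul _ _ _ hsteps

end triple

/-- The memory between two steps of the algorithm: the parameters have not been overwritten, cell
`0` of array `2` holds `m`, and array `1` holds `z`. -/
structure Holds (n : ℕ) {d : ℕ} (δ α m : ℝ) (z : Fin d → ℝ) (σ : State) : Prop where
  rows : σ.nat 0 = n
  columns : σ.nat 1 = d
  delta : σ.real 0 1 = δ
  alpha : σ.real 0 2 = α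
  cell : σ.real 2 0 = m
  array : ∀ j : Fin d, σ.real 1 j = z j

section holds

variable {E : Env} {n d : ℕ} {δ α m x : ℝ} {z : Fin d → ℝ} {k : Fin d} {σ : State} {s : Program}
  {B : ℕ}

lemma State.setNat_nat (σ : State) (r k i : ℕ) :
    (σ.setNat r k).nat i = if i = r then k else σ.nat i :=
  Function.update_apply ..

lemma Holds.setNat (h : Holds n δ α m z σ) {r : ℕ} (hr : 2 ≤ r) (k : ℕ) :
    Holds n δ α m z (σ.setNat r k) where
  rows := by rw [State.setNat_nat, if_neg (by omega), h.rows]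
  columns := by rw [State.setNat_nat, if_neg (by omega), h.columns]
  delta := h.delta
  alpha := h.alpha
  cell := h.cell
  array := h.array

lemma Holds.setReal_array (h : Holds n δ α m z σ) (k : Fin d) (x : ℝ) :
    Holds n δ α m (Function.update z k x) (σ.setReal 1 k x) where
  rows := h.rows
  columns := h.columns
  delta := by simp [State.setReal, h.delta]
  alpha := by simp [State.setReal, h.alpha]
  cell := by simp [State.setReal, h.cell]
  array j := by simp [State.setReal, Function.update_apply, h.array, Fin.val_inj]

lemma Holds.setReal_cell (h : Holds n δ α m z σ) (x : ℝ) :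
    Holds n δ α x z (σ.setReal 2 0 x) where
  rows := h.rows
  columns := h.columns
  delta := by simp [State.setReal, h.delta]
  alpha := by simp [State.setReal, h.alpha]
  cell := by simp [State.setReal]
  array := by simp [State.setReal, h.array]

lemma triple_setColumn {p : State → Prop} {e : RExpr}
    (hp : ∀ σ, p σ → Holds n δ α m z σ ∧ σ.nat 2 = k) (he : ∀ σ, p σ → e.eval E σ = x) :
    Triple E p (.setReal 1 (.reg 2) e) (1 + e.cost + 1)
      fun σ => Holds n δ α m (Function.update z k x) σ ∧ σ.nat 2 = k :=
  triple_setReal fun σ hσ => by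
    obtain ⟨h, hk⟩ := hp σ hσ
    rw [he σ hσ, NExpr.eval, hk]
    exact ⟨h.setReal_array k x, hk⟩

lemma triple_columnLoop (f : Fin d → ℝ → ℝ)
    (hs : ∀ (k : Fin d) (z : Fin d → ℝ), Triple E (fun σ => Holds n δ α m z σ ∧ σ.nat 2 = k) s B
      fun σ => Holds n δ α m (Function.update z k (f k (z k))) σ ∧ σ.nat 2 = k) :
    Triple E (Holds n δ α m z) (.loop 2 (.reg 1) s) (2 + d * (1 + B))
      (Holds n δ α m fun j => f j (z j)) := by
  set y : ℕ → Fin d → ℝ := fun k j => if (j : ℕ) < k then f j (z j) else z j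
  have hy (k : Fin d) : Function.update (y k) k (f k (y k k)) = y (k + 1) := by
    ext j
    rcases lt_trichotomy j k with h | rfl | h
    · simp [y, h.ne, Order.lt_add_one_iff, h.not_ge, h.le]
    · simp [y]
    · simp [y, h.ne', Order.lt_add_one_iff, h.not_ge, h.not_gt]
  have hloop := Triple.loop (E := E) (I := fun k => Holds n δ α m (y k)) (e := .reg 1) (a := 2)
    (J := fun k σ => Holds n δ α m (y k) σ ∧ σ.nat 2 = k) (fun σ h => h.columns)
    (fun k σ h => ⟨h.setNat le_rfl k, by simp [State.setNat_nat]⟩)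
    fun k hk => (hs ⟨k, hk⟩ (y k)).imp fun σ h => hy ⟨k, hk⟩ ▸ h.1
  simpa [y, NExpr.cost] using hloop

end holds

/-- The constant `k`. -/
def numeral (k : ℕ) : RExpr := .ofNat (.const k)

/-- The expression for `log (log d)`. -/
def logLogExpr : RExpr := .log (.log (.ofNat (.reg 1)))

/-- The expression for `κ = √(log (log d))`. -/
def kappaExpr : RExpr := .sqrt logLogExpr

/-- The expression for `noiseTailInv κ p`. -/
def noiseTailInvExpr (p : RExpr) : RExpr :=
  let y : RExpr := .log (.sub (numeral 1) (.log p))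
  .sub (.sqrt (.add (.add (numeral 1) (.mul (numeral 2) y))
    (.mul (.div y kappaExpr) (.div y kappaExpr)))) (numeral 1)

/-- The program that writes product noise to array `1`. -/
def productNoiseProgram : Program :=
  let u : RExpr := .unif (.reg 2)
  let scale : RExpr := .div (.read 0 (.const 2)) (.mul (numeral 3) kappaExpr)
  .loop 2 (.reg 1) (.ifLE u (.div (numeral 1) (numeral 2))
    (.setReal 1 (.reg 2)
      (.mul scale (.sub (numeral 0) (noiseTailInvExpr (.mul (numeral 2) u)))))
    (.setReal 1 (.reg 2)
      (.mul scale (noiseTailInvExpr (.sub (numeral 2) (.mul (numeral 2) u))))))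

/-- The program that writes the largest of the uniform draws `d, …, 2 d - 1` to cell `0` of
array `2`. -/
def maxProgram : Program :=
  let u : RExpr := .unif (.add (.reg 1) (.reg 3))
  .loop 3 (.reg 1) (.ifLE (.read 2 (.const 0)) u (.setReal 2 (.const 0) u) .skip)

/-- The program that writes cube noise to array `1`. -/
def cubeNoiseProgram : Program :=
  .seq maxProgram (.loop 2 (.reg 1) (.setReal 1 (.reg 2)
    (.mul (.div (.div (.read 0 (.const 2)) (numeral 3)) (.read 2 (.const 0)))
      (.sub (.mul (numeral 2) (.unif (.reg 2))) (numeral 1)))))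

/-- The program that adds to cell `j` of array `1` the mean of column `j` of the database, where
`j` is in register `2`. -/
def addMeanProgram : Program :=
  .loop 3 (.reg 0) (.setReal 1 (.reg 2)
    (.add (.read 1 (.reg 2)) (.div (.data (.reg 3) (.reg 2)) (.ofNat (.reg 0)))))

/-- The program that projects cell `j` of array `1` onto `[-1, 1]`, where `j` is in register
`2`. -/
def clipProgram : Program :=
  let cell : RExpr := .read 1 (.reg 2)
  let negOne : RExpr := .sub (numeral 0) (numeral 1)
  .seq (.ifLE (numeral 1) cell (.setReal 1 (.reg 2) (numeral 1)) .skip)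
    (.ifLE negOne cell .skip (.setReal 1 (.reg 2) negOne))

/-- The program that writes `marginalNoise` to array `1`. -/
def noiseProgram : Program :=
  .ifLE (.ofNat (.reg 1))
    (.mul (.add (numeral 1) (.log (.div (numeral 1) (.read 0 (.const 1))))) logLogExpr)
    cubeNoiseProgram productNoiseProgram

/-- The program that adds the marginals of the database to array `1` and projects the result onto
the cube. -/
def addMarginalsProgram : Program :=
  .loop 2 (.reg 1) (.seq addMeanProgram clipProgram)

/-- The algorithm `P` of the theorem; it implements `marginalMechanism`. -/
def marginalProgram : Program :=
  .ifLE logLogExpr (numeral 1) .skip (.seq noiseProgram addMarginalsProgram)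

section correctness

variable {E : Env} {n d : ℕ} {δ α m : ℝ} {z : Fin d → ℝ} {σ : State} {ω : Randomness}

lemma norm_fin_succ (f : ℕ → ℝ) (k : ℕ) :
    ‖fun i : Fin (k + 1) => f i‖ = max ‖fun i : Fin k => f i‖ ‖f k‖ := by
  simp only [Pi.norm_def, Fin.univ_castSuccEmb, Finset.sup_cons, Finset.sup_map]
  rw [max_comm, ← coe_nnnorm (f k), ← NNReal.coe_max]
  rfl

lemma triple_maxProgram : Triple E (Holds n δ α 0 z) maxProgram (2 + d * 16)
    (Holds n δ α ‖uniforms (fun i : Fin d => d + i) E.rand‖ z) := by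
  set f : ℕ → ℝ := fun i => E.rand.1 (d + i)
  set I : ℕ → State → Prop := fun k => Holds n δ α ‖fun i : Fin k => f i‖ z
  have hf (k : ℕ) : ‖f k‖ = f k := Real.norm_of_nonneg (E.rand.1 (d + k)).2.1
  have hI (k : ℕ) : Triple E (fun σ => I k σ ∧ σ.nat 3 = k)
      (.ifLE (.read 2 (.const 0)) (.unif (.add (.reg 1) (.reg 3)))
        (.setReal 2 (.const 0) (.unif (.add (.reg 1) (.reg 3)))) .skip) 15 (I (k + 1)) := by
    refine Triple.mono (Triple.ifLE (triple_setReal ?_) (triple_skip ?_)) (by decide)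
    all_goals
      rintro σ ⟨⟨h, hk⟩, hle⟩
      simp only [RExpr.eval, NExpr.eval, h.cell, h.columns, hk] at hle ⊢
      simp only [I, norm_fin_succ]
    · rw [show max ‖fun i : Fin k => f i‖ ‖f k‖ = f k by rw [hf, max_eq_right hle]]
      exact h.setReal_cell (f k)
    · rw [show max ‖fun i : Fin k => f i‖ ‖f k‖ = ‖fun i : Fin k => f i‖ by
        rw [hf, max_eq_left hle.le]]
      exact h
  have hloop := Triple.loop (N := d) (a := 3) (e := .reg 1) (I := I) (fun σ h => h.columns)
    (fun k σ h => ⟨h.setNat (by norm_num) k, by simp [State.setNat_nat]⟩) fun k _ => hI k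
  rwa [show I 0 = Holds n δ α 0 z by simp only [I, Pi.norm_def]; simp] at hloop

lemma logLogExpr_eval (h : Holds n δ α m z σ) :
    logLogExpr.eval E σ = Real.log (Real.log d) := by
  simp [logLogExpr, RExpr.eval, NExpr.eval, h.columns]

lemma noiseTailInvExpr_eval (h : Holds n δ α m z σ) (p : RExpr) :
    (noiseTailInvExpr p).eval E σ = noiseTailInv √(Real.log (Real.log d)) (p.eval E σ) := by
  simp [noiseTailInvExpr, kappaExpr, numeral, RExpr.eval, NExpr.eval, logLogExpr_eval h,
    noiseTailInv, tailExponentInv, sq]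

lemma triple_cubeNoiseProgram : Triple E (Holds n δ α 0 z) cubeNoiseProgram (4 + d * 40)
    (fun σ => ∃ m, Holds n δ α m (cubeNoiseDraw d (α / 3) E.rand) σ) := by
  refine ((triple_maxProgram.seq (triple_columnLoop
    (fun j _ => cubeNoiseDraw d (α / 3) E.rand j) fun k z => triple_setColumn (fun σ h => h)
      fun σ h => ?_)).mono ?_).imp fun σ h => ⟨_, h⟩
  · obtain ⟨h, hk⟩ := h
    simp [RExpr.eval, NExpr.eval, numeral, hk, h.alpha, h.cell, cubeNoiseDraw, cubeNoise, uniforms]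
  · simp only [RExpr.cost, NExpr.cost, numeral]
    omega

lemma triple_productNoiseProgram : Triple E (Holds n δ α m z) productNoiseProgram (2 + d * 100)
    (Holds n δ α m (productNoiseDraw d √(Real.log (Real.log d))
      (α / (3 * √(Real.log (Real.log d)))) E.rand)) := by
  set κ := √(Real.log (Real.log d)) with hκ
  refine triple_columnLoop (B := 99) (fun j _ => α / (3 * κ) * quantile κ (E.rand.1 j))
    fun k z => ?_
  refine Triple.mono (Triple.ifLE (triple_setColumn (fun σ h => h.1) ?_)
    (triple_setColumn (fun σ h => h.1) ?_)) (by decide)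
  all_goals
    rintro σ ⟨⟨h, hk⟩, hu⟩
    simp only [RExpr.eval, NExpr.eval, numeral, hk, Nat.cast_one, Nat.cast_ofNat] at hu
  · rw [quantile, if_pos hu]
    simp [RExpr.eval, NExpr.eval, numeral, noiseTailInvExpr_eval h, logLogExpr_eval h, kappaExpr,
      hk, h.alpha, hκ]
  · rw [quantile, if_neg hu.not_ge]
    simp [RExpr.eval, NExpr.eval, numeral, noiseTailInvExpr_eval h, logLogExpr_eval h, kappaExpr,
      hk, h.alpha, hκ]

lemma marginals_eq_sum_data (D : Database n d) (ω : Randomness) (j : Fin d) :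
    marginals D j = ∑ i ∈ Finset.range n, (inputEnv D ω).data i j / n := by
  simp [marginals, inputEnv, Finset.sum_range, Finset.mul_sum, div_eq_inv_mul]

lemma triple_addMeanProgram (D : Database n d) (k : Fin d) :
    Triple (inputEnv D ω) (fun σ => Holds n δ α m z σ ∧ σ.nat 2 = k) addMeanProgram (2 + n * 12)
      fun σ => Holds n δ α m (Function.update z k (marginals D k + z k)) σ ∧ σ.nat 2 = k := by
  set f : ℕ → ℝ := fun l => ∑ i ∈ Finset.range l, (inputEnv D ω).data i k / n + z k
  set I : ℕ → State → Prop := fun l σ => Holds n δ α m (Function.update z k (f l)) σ ∧ σ.nat 2 = k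
  have hI (l : ℕ) : Triple (inputEnv D ω) (fun σ => I l σ ∧ σ.nat 3 = l)
      (.setReal 1 (.reg 2)
        (.add (.read 1 (.reg 2)) (.div (.data (.reg 3) (.reg 2)) (.ofNat (.reg 0))))) 11
      (I (l + 1)) := by
    have hcell := triple_setColumn (E := inputEnv D ω) (x := f (l + 1))
      (p := fun σ => I l σ ∧ σ.nat 3 = l) (fun σ h => h.1)
      (e := .add (.read 1 (.reg 2)) (.div (.data (.reg 3) (.reg 2)) (.ofNat (.reg 0)))) ?_
    · simp only [I, Function.update_idem] at hcell
      exact hcell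
    · rintro σ ⟨⟨h, hk⟩, hl⟩
      simp only [RExpr.eval, NExpr.eval, hk, hl, h.rows, h.array, Function.update_self, f,
        Finset.sum_range_succ]
      ring
  have hloop := Triple.loop (N := n) (a := 3) (e := .reg 0) (I := I) (fun σ h => h.1.rows)
    (fun l σ h => ⟨⟨h.1.setNat (by norm_num) l, by simp [State.setNat_nat, h.2]⟩,
      by simp [State.setNat_nat]⟩) fun l _ => hI l
  simp only [I, f, Finset.sum_range_zero, zero_add, Function.update_eq_self] at hloop
  rwa [← marginals_eq_sum_data] at hloop

lemma triple_clipProgram (k : Fin d) :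
    Triple E (fun σ => Holds n δ α m z σ ∧ σ.nat 2 = k) clipProgram 24
      fun σ => Holds n δ α m (Function.update z k (max (-1) (min 1 (z k)))) σ ∧ σ.nat 2 = k := by
  have hcap : Triple E (fun σ => Holds n δ α m z σ ∧ σ.nat 2 = k)
      (.ifLE (numeral 1) (.read 1 (.reg 2)) (.setReal 1 (.reg 2) (numeral 1)) .skip) 9
      fun σ => Holds n δ α m (Function.update z k (min 1 (z k))) σ ∧ σ.nat 2 = k := by
    refine Triple.mono (Triple.ifLE (triple_setColumn (fun σ h => h.1) ?_) (triple_skip ?_))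
      (by decide)
    all_goals
      rintro σ ⟨⟨h, hk⟩, hle⟩
      simp only [numeral, RExpr.eval, NExpr.eval, hk, h.array, Nat.cast_one] at hle ⊢
    · rw [min_eq_left hle]
    · rw [min_eq_right hle.le, Function.update_eq_self]
      exact ⟨h, trivial⟩
  have hfloor (z : Fin d → ℝ) : Triple E (fun σ => Holds n δ α m z σ ∧ σ.nat 2 = k)
      (.ifLE (.sub (numeral 0) (numeral 1)) (.read 1 (.reg 2)) .skip
        (.setReal 1 (.reg 2) (.sub (numeral 0) (numeral 1)))) 15
      fun σ => Holds n δ α m (Function.update z k (max (-1) (z k))) σ ∧ σ.nat 2 = k := by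
    refine Triple.mono (Triple.ifLE (triple_skip ?_) (triple_setColumn (fun σ h => h.1) ?_))
      (by decide)
    all_goals
      rintro σ ⟨⟨h, hk⟩, hle⟩
      simp only [numeral, RExpr.eval, NExpr.eval, hk, h.array, Nat.cast_one, Nat.cast_zero,
        zero_sub] at hle ⊢
    · rw [max_eq_right hle, Function.update_eq_self]
      exact ⟨h, trivial⟩
    · rw [max_eq_left hle.le]
  have hseq := hcap.seq (hfloor _)
  simp only [Function.update_self, Function.update_idem] at hseq
  exact hseq

lemma triple_noiseProgram : Triple E (Holds n δ α 0 z) noiseProgram (25 + d * 100)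
    fun σ => ∃ m, Holds n δ α m (marginalNoise d δ α E.rand) σ := by
  have hcond {σ : State} (h : Holds n δ α 0 z σ) :
      (RExpr.mul (.add (numeral 1) (.log (.div (numeral 1) (.read 0 (.const 1)))))
        logLogExpr).eval E σ = (1 + Real.log (1 / δ)) * Real.log (Real.log d) := by
    simp [RExpr.eval, NExpr.eval, numeral, logLogExpr_eval h, h.delta]
  refine Triple.mono (Triple.ifLE (A := 4 + d * 40) (B := 2 + d * 100) ?_ ?_) ?_
  · rintro σ ⟨h, hle⟩
    rw [hcond h, RExpr.eval, NExpr.eval, h.columns] at hle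
    rw [marginalNoise, if_pos hle]
    exact triple_cubeNoiseProgram σ h
  · rintro σ ⟨h, hlt⟩
    rw [hcond h, RExpr.eval, NExpr.eval, h.columns] at hlt
    rw [marginalNoise, if_neg hlt.not_ge]
    have hprod := triple_productNoiseProgram (E := E) σ h
    exact ⟨hprod.1, 0, hprod.2⟩
  · simp only [RExpr.cost, NExpr.cost, numeral, logLogExpr]
    omega

lemma triple_addMarginalsProgram (D : Database n d) :
    Triple (inputEnv D ω) (Holds n δ α m z) addMarginalsProgram (2 + d * (27 + n * 12))
      (Holds n δ α m (clip (marginals D + z)).toReal) := by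
  have hcell (k : Fin d) (z : Fin d → ℝ) := (triple_addMeanProgram (δ := δ) (α := α) (m := m)
    (z := z) (ω := ω) D k).seq (triple_clipProgram k)
  simp only [Function.update_self, Function.update_idem] at hcell
  refine Triple.mono (triple_columnLoop (fun j x => max (-1) (min 1 (marginals D j + x))) hcell) ?_
  ring_nf
  exact le_rfl

lemma triple_marginalProgram (D : Database n d) (ω : Randomness) :
    Triple (inputEnv D ω) (Holds n δ α 0 (0 : Fin d → ℝ)) marginalProgram
      (40 + d * (127 + n * 12))
      fun σ => ∃ m, Holds n δ α m (if Real.log (Real.log d) ≤ 1 then 0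
        else (clip (marginals D + marginalNoise d δ α ω)).toReal) σ := by
  have hadd (m : ℝ) : Triple (inputEnv D ω) (Holds n δ α m (marginalNoise d δ α ω))
      addMarginalsProgram (2 + d * (27 + n * 12))
      fun σ => ∃ m, Holds n δ α m (clip (marginals D + marginalNoise d δ α ω)).toReal σ :=
    (triple_addMarginalsProgram D).imp fun _ h => ⟨m, h⟩
  refine Triple.mono (Triple.ifLE (triple_skip ?_)
    (B := (25 + d * 100) + (2 + d * (27 + n * 12))) ?_) ?_
  · rintro σ ⟨h, hle⟩
    rw [logLogExpr_eval h, numeral, RExpr.eval, NExpr.eval, Nat.cast_one] at hle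
    rw [if_pos hle]
    exact ⟨0, h⟩
  · rintro σ ⟨h, hlt⟩
    rw [logLogExpr_eval h, numeral, RExpr.eval, NExpr.eval, Nat.cast_one] at hlt
    rw [if_neg hlt.not_ge]
    exact triple_noiseProgram.seq (Triple.exists hadd) σ h
  · simp only [RExpr.cost, NExpr.cost, numeral, logLogExpr]
    ring_nf
    omega

lemma holds_initState (n d : ℕ) (ε δ α : ℝ) :
    Holds n δ α 0 (0 : Fin d → ℝ) (initState n d ε δ α) where
  rows := rfl
  columns := rfl
  delta := by simp [initState]
  alpha := by simp [initState]
  cell := by simp [initState]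
  array := by simp [initState]

lemma output_marginalProgram (ε δ α : ℝ) (D : Database n d) (ω : Randomness) :
    marginalProgram.output ε δ α D ω = if Real.log (Real.log d) ≤ 1 then 0
      else (clip (marginals D + marginalNoise d δ α ω)).toReal := by
  obtain ⟨m, h⟩ := (triple_marginalProgram D ω _ (holds_initState n d ε δ α)).2
  exact funext h.array

theorem runtime_marginalProgram_le (hd : 1 ≤ d) (ε δ α : ℝ) (D : Database n d)
    (ω : Randomness) : marginalProgram.runtime ε δ α D ω ≤ 200 * (n + d) ^ 2 := by
  have hsteps := (triple_marginalProgram D ω _ (holds_initState n d ε δ α)).1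
  refine hsteps.trans ?_
  nlinarith [sq_nonneg n]

theorem implements_marginalProgram (n d : ℕ) (ε δ α : ℝ) :
    marginalProgram.Implements ε δ α (marginalMechanism n d δ α) := by
  by_cases hL : Real.log (Real.log d) ≤ 1
  · intro D
    have hout : marginalProgram.output ε δ α D = fun _ => 0 := by
      ext1 ω
      rw [output_marginalProgram, if_pos hL]
    have hclip : (clip (0 : Fin d → ℝ)).toReal = 0 := by
      ext j
      simp [clip, Cube.toReal, Set.coe_projIcc]
    rw [hout, marginalMechanism_of_le hL]
    refine ⟨measurable_const, ?_⟩
    rw [Measure.map_const, measure_univ, one_smul]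
    change _ = (Measure.dirac _).map _
    rw [Measure.map_dirac' measurable_toReal, hclip]
  · rw [marginalMechanism_of_lt (not_le.1 hL)]
    exact implements_noiseMechanism (measurable_marginalNoise d δ α) rfl fun D ω => by
      rw [output_marginalProgram, if_neg hL]

end correctness

end OneWayMarginals

end

/-- Answering one-way marginals in the sup norm with approximate differential privacy. One program
`P`, with running time polynomial in `n` and `d`, serves all parameters; `w` is the `ω(1)` in the
exponent; the constant `C` of the sample bound depends only on the upper bounds `ε₀` for `ε` and
`δ₀ < 1` for `δ`. -/
theorem theorem1p3 :
    ∃ (P : Program) (K : ℕ) (w : ℕ → ℝ), Filter.Tendsto w Filter.atTop Filter.atTop ∧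
      ∀ ε₀ δ₀ : ℝ, δ₀ < 1 → ∃ C : ℝ, 0 < C ∧
        ∀ ε δ α : ℝ, 0 < ε → ε ≤ ε₀ → 0 < δ → δ ≤ δ₀ → 0 < α →
        ∀ d n : ℕ, 1 ≤ d → 1 ≤ n →
          C * (Real.sqrt (d * Real.log (1 / δ) * Real.log (Real.log d)) / (ε * α)) ≤ n →
          ∃ M : Mechanism n d,
            (P.Implements ε δ α M ∧
              ∀ (D : Database n d) (ω : Randomness), P.runtime ε δ α D ω ≤ K * (n + d) ^ K) ∧
            IsDP ε δ M ∧
            ∀ D : Database n d,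
              (M D : MeasureTheory.Measure (Cube d)).real {y | α ≤ ‖y.toReal - marginals D‖} ≤
                1 / (d : ℝ) ^ w d := by
  refine ⟨marginalProgram, 200, fun d => Real.log d - 3,
    tendsto_atTop_add_const_right _ (-3)
      (Real.tendsto_log_atTop.comp tendsto_natCast_atTop_atTop),
    fun ε₀ δ₀ hδ₀ => ⟨sampleConstant ε₀ δ₀, sampleConstant_pos ε₀ δ₀,
      fun ε δ α hε hεε₀ hδ hδδ₀ hα d n hd hn hsample => ?_⟩⟩
  refine ⟨marginalMechanism n d δ α, ⟨implements_marginalProgram n d ε δ α, fun D ω => ?_⟩,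
    isDP_marginalMechanism_of_sampleConstant hn hε hεε₀ hδ hδδ₀ hδ₀ hα hsample,
    marginalMechanism_le_norm_sub_le hn hd δ hα⟩
  calc marginalProgram.runtime ε δ α D ω ≤ 200 * (n + d) ^ 2 :=
        runtime_marginalProgram_le hd ε δ α D ω
    _ ≤ 200 * (n + d) ^ 200 :=
        Nat.mul_le_mul_left _ (Nat.pow_le_pow_right (by omega) (by norm_num))
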